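/- Let $S$ be a closed topological surface with a cellular decomposition $\Sigma=(V,E,F)$ in which every 2-cell is a polygon with at least one side (a 2-cell may lie on both sides of a 1-cell), and let $\Phi\in(0,\frac{\pi}{2})^{E}$ be a weight. Given radii $r\in(0,\frac{\pi}{2}]^{F}$, for every 1-cell $e$ take two disks in the unit sphere $\mathbb S^2$ with the radii of the 2-cells on the two sides of $e$, such that the bigon $B_e$ in which they intersect has interior angle $\Phi(e)$. The centers of the two disks and the two intersection points of their boundary circles are the corners of a spherical quadrilateral $Q(e)$. Gluing the $Q(e)$ along their sides according to $\Sigma$ gives a spherical conical metric on $S$ with a circle pattern (the disks) realizing $(\Sigma,\Phi)$. "Spherical conical metric" below means such a metric with its circle pattern, and "isometry" means an isometry isotopic to the identity of $S$ that takes one circle pattern to the other. The geodesic curvatures of the metric form the vector $k=(\cot r_f)_{f\in F}\in\mathbb R_{\ge 0}^{F}$. Its total geodesic curvature is $L=(L_f)_{f\in F}$, where $L_f$ is the sum of $k_f\,\ell$ over all sides of 1-cells on which $f$ lies (a 1-cell with $f$ on both sides is counted twice), $\ell$ being the length of the side of the bigon $B_e$ on the boundary circle of the corresponding disk. For $F'\subset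 F$ let $E_{F'}$ be the set of 1-cells contained in the boundary of some 2-cell of $F'$. For $I\subset F$ put $\mathbb R^F_I=\{k\in\mathbb R^F: k_f>0 \text{ for } f\in I,\ k_f=0 \text{ for } f\notin I\}$ and $$\mathcal L_I=\Big\{L\in\mathbb R^F_I : \sum_{f\in F'}L_f<2\sum_{e\in E_{F'}}\Phi(e)\ \text{ for all } \emptyset\ne F'\subset I\Big\},$$ and let $$\mathcal L_1=\mathcal L_F,\qquad \bar\partial\mathcal L=\bigcup_{\emptyset\ne I\subsetneq F}\mathcal L_I\cup\{0\},\qquad \mathcal L=\mathcal L_1\cup\bar\partial\mathcal L,\qquad \bar\partial\mathbb R^F_{\ge0}=\bigcup_{\emptyset\ne I\subsetneq F}\mathbb R^F_I\cup\{0\}.$$ Then for $\hat L\in\mathbb R^F$ there exists a spherical conical metric on $S$ with total geodesic curvature $\hat L$ if and only if $\hat L\in\mathcal L$, and it is unique up to isometry if it exists. Moreover, every $k\in\mathbb R^F_{\ge0}$ is the vector of geodesic curvatures of a spherical conical metric, unique up to isometry, and the map $\mathcal E$ that sends $k$ to the total geodesic curvature of this metric is a homeomorphism from $\mathbb R^F_{\ge0}$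 onto $\mathcal L$ that maps $\mathbb R^F_{>0}$ onto $\mathcal L_1$, $\bar\partial\mathbb R^F_{\ge0}$ onto $\bar\partial\mathcal L$, and $\mathbb R^F_I$ onto $\mathcal L_I$ for every $I\subset F$. -/

import Mathlib

open scoped ENNReal RealInnerProductSpace

noncomputable section

namespace CirclePattern

/-! ### Cellular decompositions of closed surfaces -/

/-- The flags of a cellular decomposition with set of 1-cells `E`: a flag `(e, b, h)` is a 1-cell `e`,
one of its two sides `b` and one of its two ends `h`. Each flag is a triangle of the barycentric
subdivision: its corners are the end `h` of `e`, an interior point of `e`, and the auxiliary point of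
the 2-cell that lies on the side `b` of `e`. -/
abbrev CellFlag (E : Type*) := E × Bool × Bool

/-- The neighbouring flag at the other end of the same side of the same 1-cell. -/
def CellFlag.swapEnd {E : Type*} (x : CellFlag E) : CellFlag E := (x.1, x.2.1, !x.2.2)

/-- The neighbouring flag across the 1-cell. -/
def CellFlag.swapSide {E : Type*} (x : CellFlag E) : CellFlag E := (x.1, !x.2.1, x.2.2)

/-- The combinatorial data of a cellular decomposition of a closed surface (orientable or not) with
1-cells `E` and 2-cells `F`. The map `turn` sends a flag to the other flag that has the same corner of
the same 2-cell, and the 2-cells are the cycles of flags under `swapEnd` and `turn`, so they are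
polygons with at least one side. A 2-cell may have one or two sides, and it may lie on both sides of
a 1-cell. The 0-cells are the cycles of flags under `swapSide` and `turn`. -/
structure FlagGluing (E F : Type*) where
  turn : CellFlag E → CellFlag E
  turn_turn : ∀ x, turn (turn x) = x
  turn_ne : ∀ x, turn x ≠ x
  face : CellFlag E → F
  face_surjective : Function.Surjective face
  face_eq_iff : ∀ x y, face x = face y ↔
    Relation.EqvGen (fun x y : CellFlag E => y = x.swapEnd ∨ y = turn x) x y

/-- A closed triangle in barycentric coordinates. Coordinate `0` belongs to the 0-cell, coordinate `1`
to the point on the 1-cell, coordinate `2` to the auxiliary point of the 2-cell. -/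
abbrev Triangle := stdSimplex ℝ (Fin 3)

variable {S E F : Type*}

namespace FlagGluing

/-- Two flag triangles that are neighbours are glued along their common side, which is the side on
which the coordinate of the corner that changes vanishes. -/
def glue (G : FlagGluing E F) (a b : Σ _ : CellFlag E, Triangle) : Prop :=
  a.2 = b.2 ∧
    ((a.2 0 = 0 ∧ b.1 = a.1.swapEnd) ∨
     (a.2 1 = 0 ∧ b.1 = G.turn a.1) ∨
     (a.2 2 = 0 ∧ b.1 = a.1.swapSide))

/-- The surface obtained by gluing the flag triangles, with the quotient topology. -/
abbrev Realization (G : FlagGluing E F) := Quot G.glue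

/-- The 2-cell on the side `b` of the 1-cell `e`. -/
def sideFace (G : FlagGluing E F) (e : E) (b : Bool) : F := G.face (e, b, false)

open scoped Classical in
/-- `E_{F'}`: the 1-cells contained in the boundary of some 2-cell of `F'`. -/
def edgesOf [Fintype E] (G : FlagGluing E F) (F' : Finset F) : Finset E :=
  Finset.univ.filter fun e => ∃ b, G.sideFace e b ∈ F'

end FlagGluing

/-- A cellular decomposition of the topological space `S` with 1-cells `E` and 2-cells `F`. -/
structure CellularDecomposition (S : Type*) [TopologicalSpace S] (E F : Type*)
    extends FlagGluing E F where
  homeo : toFlagGluing.Realization ≃ₜ S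

/-- The point of `S` with coordinates `p` in the triangle of the flag `x`. -/
def CellularDecomposition.point [TopologicalSpace S] (D : CellularDecomposition S E F)
    (x : CellFlag E) (p : Triangle) : S :=
  D.homeo (Quot.mk _ ⟨x, p⟩)

/-! ### Spherical geometry -/

/-- Euclidean 3-space; `𝕊²` is its unit sphere, whose geodesic distance is the angle. -/
abbrev E3 := EuclideanSpace ℝ (Fin 3)

/-- The open spherical disk with center `c` and radius `r`. -/
def sphDisk (c : E3) (r : ℝ) : Set E3 :=
  {x | ‖x‖ = 1 ∧ InnerProductGeometry.angle c x < r}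

/-- The spherical circle with center `c` and radius `r`. -/
def sphCircle (c : E3) (r : ℝ) : Set E3 :=
  {x | ‖x‖ = 1 ∧ InnerProductGeometry.angle c x = r}

/-- The angle at the point `p` of the unit sphere between the great circle arcs from `p` to `a` and
from `p` to `b`: the angle of the components of `a` and `b` tangent to the sphere at `p`. -/
def sphAngle (p a b : E3) : ℝ :=
  InnerProductGeometry.angle (a - ⟪p, a⟫ • p) (b - ⟪p, b⟫ • p)

/-! ### Spherical conical metrics with circle pattern -/

/-- A spherical conical metric on `S` with a circle pattern that realizes the decomposition `D` and the
weight `Φ`, given by the spherical quadrilaterals from which it is glued. To every 2-cell belongs a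
radius in `(0, π/2]`. To every 1-cell `e` belong two disks in the unit sphere with centers
`center e b` and with the radii of the 2-cells on the sides `b` of `e`. The boundary circles of these
disks meet in the two points `corner e h`, and the interior angle there of the bigon in which the
disks intersect, which is `π` minus the angle between the directions to the centers, is `Φ e`. The
quadrilateral of `e` has the corners `center e false`, `corner e false`, `center e true`,
`corner e true`. -/
structure SphericalConicalMetric [TopologicalSpace S] (D : CellularDecomposition S E F)
    (Φ : E → ℝ) where
  radius : F → ℝ
  radius_mem : ∀ f, radius f ∈ Set.Ioc 0 (Real.pi / 2)
  center : E → Bool → E3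
  corner : E → Bool → E3
  norm_center : ∀ e b, ‖center e b‖ = 1
  corner_mem : ∀ e b h, corner e h ∈ sphCircle (center e b) (radius (D.sideFace e b))
  corner_ne : ∀ e, corner e false ≠ corner e true
  angle_corner : ∀ e h,
    Real.pi - sphAngle (corner e h) (center e false) (center e true) = Φ e

namespace SphericalConicalMetric

variable [TopologicalSpace S] {D : CellularDecomposition S E F} {Φ : E → ℝ}

/-- The radius of the disk on the side `b` of `e`. -/
def sideRadius (μ : SphericalConicalMetric D Φ) (e : E) (b : Bool) : ℝ :=
  μ.radius (D.sideFace e b)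

/-- The geodesic curvature `cot r` of the circles of the pattern. -/
def geodesicCurvature (μ : SphericalConicalMetric D Φ) (f : F) : ℝ := Real.cot (μ.radius f)

/-- The side on `∂D_b` of the bigon `D_false ∩ D_true` of the 1-cell `e`. -/
def bigonSide (μ : SphericalConicalMetric D Φ) (e : E) (b : Bool) : Set E3 :=
  sphCircle (μ.center e b) (μ.sideRadius e b) ∩ sphDisk (μ.center e (!b)) (μ.sideRadius e (!b))

/-- The length of a side of the bigon of `e`. -/
def sideLength (μ : SphericalConicalMetric D Φ) (e : E) (b : Bool) : ℝ :=
  (MeasureTheory.Measure.hausdorffMeasure (1 : ℝ) (μ.bigonSide e b)).toReal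

open scoped Classical in
/-- The total geodesic curvature `L_f`: the sum, over all sides of 1-cells on which `f` lies, of
the geodesic curvature times the length of the corresponding side of the bigon. -/
def totalGeodesicCurvature [Fintype E] (μ : SphericalConicalMetric D Φ) (f : F) : ℝ :=
  ∑ s : E × Bool with D.sideFace s.1 s.2 = f, μ.geodesicCurvature f * μ.sideLength s.1 s.2

/-- The point in the middle of the bigon of `e`: it lies on the great circle arc between the two
centers, at distance `(d + r - r') / 2` from the first one, where `d` is the distance of the centers
and `r`, `r'` are the radii. -/
def edgePoint (μ : SphericalConicalMetric D Φ) (e : E) : E3 :=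
  let d := InnerProductGeometry.angle (μ.center e false) (μ.center e true)
  let a := (d + μ.sideRadius e false - μ.sideRadius e true) / 2
  (Real.sin d)⁻¹ • (Real.sin (d - a) • μ.center e false + Real.sin a • μ.center e true)

/-- The parametrization, by the triangle of a flag `(e, b, h)`, of the spherical triangle with corners
`corner e h`, `edgePoint e`, `center e b`. The four flags of `e` fill its quadrilateral. -/
def chart (μ : SphericalConicalMetric D Φ) (x : CellFlag E) (p : Triangle) : E3 :=
  let y := p 0 • μ.corner x.1 x.2.2 + p 1 • μ.edgePoint x.1 + p 2 • μ.center x.1 x.2.1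
  ‖y‖⁻¹ • y

/-- The spherical distance of two points of `S` within a common flag triangle (`∞` if there is
none). -/
def stepDist (μ : SphericalConicalMetric D Φ) (x y : S) : ℝ≥0∞ :=
  ⨅ (i : CellFlag E) (p : Triangle) (q : Triangle) (_ : D.point i p = x) (_ : D.point i q = y),
    ENNReal.ofReal (InnerProductGeometry.angle (μ.chart i p) (μ.chart i q))

/-- The distance function on `S` of the glued metric: the infimum of the lengths of chains of
geodesic segments in the triangles (`∞` between different components of `S`). -/
def gluedDist (μ : SphericalConicalMetric D Φ) (x y : S) : ℝ≥0∞ :=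
  ⨅ (n : ℕ) (c : Fin (n + 1) → S) (_ : c 0 = x) (_ : c (Fin.last n) = y),
    ∑ i : Fin n, μ.stepDist (c i.castSucc) (c i.succ)

/-- The disk of the circle pattern that belongs to the 2-cell `f`, as a subset of `S`. -/
def disk (μ : SphericalConicalMetric D Φ) (f : F) : Set S :=
  {x | ∃ (e : E) (b : Bool), D.sideFace e b = f ∧ ∃ (b' h : Bool) (p : Triangle),
    D.point (e, b', h) p = x ∧ μ.chart (e, b', h) p ∈ sphDisk (μ.center e b) (μ.radius f)}

end SphericalConicalMetric

/-- A self-homeomorphism is isotopic to the identity. -/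
def IsotopicToId [TopologicalSpace S] (g : S ≃ₜ S) : Prop :=
  ∃ H : C(unitInterval × S, S), (∀ x, H (0, x) = x) ∧ (∀ x, H (1, x) = g x) ∧
    ∀ t, IsHomeomorph fun x => H (t, x)

/-- Equivalence of spherical conical metrics with circle pattern: there is an isometry, isotopic to
the identity, that takes one circle pattern to the other. -/
def SphericalConicalMetric.Isometric [TopologicalSpace S] {D : CellularDecomposition S E F}
    {Φ : E → ℝ} (μ ν : SphericalConicalMetric D Φ) : Prop :=
  ∃ g : S ≃ₜ S, (∀ x y, ν.gluedDist (g x) (g y) = μ.gluedDist x y) ∧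
    (∀ f, g '' μ.disk f = ν.disk f) ∧ IsotopicToId g

/-! ### The sets of curvatures -/

/-- The set `ℝ^{|F|}_{i₁⋯iₘ}` for `I = {i₁, …, iₘ}`: the coordinates in `I` are positive, the others
vanish. -/
def orthantStratum (I : Finset F) : Set (F → ℝ) :=
  {k | (∀ f ∈ I, 0 < k f) ∧ ∀ f ∉ I, k f = 0}

/-- The boundary of the closed orthant, as the union of its strata. -/
def orthantBoundary [Fintype F] : Set (F → ℝ) :=
  (⋃ (I : Finset F) (_ : I.Nonempty) (_ : I ≠ Finset.univ), orthantStratum I) ∪ {0}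

/-- The set `𝓛₁`. -/
def L₁ [Fintype E] (G : FlagGluing E F) (Φ : E → ℝ) : Set (F → ℝ) :=
  {L | (∀ f, 0 < L f) ∧ ∀ F' : Finset F, F'.Nonempty →
    ∑ f ∈ F', L f < 2 * ∑ e ∈ G.edgesOf F', Φ e}

/-- The set `𝓛_{i₁⋯iₘ}` for `I = {i₁, …, iₘ}`. -/
def LStratum [Fintype E] (G : FlagGluing E F) (Φ : E → ℝ) (I : Finset F) : Set (F → ℝ) :=
  {L | L ∈ orthantStratum I ∧ ∀ F' : Finset F, F' ⊆ I → F'.Nonempty →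
    ∑ f ∈ F', L f < 2 * ∑ e ∈ G.edgesOf F', Φ e}

/-- The set `∂̄𝓛`. -/
def LBoundary [Fintype E] [Fintype F] (G : FlagGluing E F) (Φ : E → ℝ) : Set (F → ℝ) :=
  (⋃ (I : Finset F) (_ : I.Nonempty) (_ : I ≠ Finset.univ), LStratum G Φ I) ∪ {0}

/-- The set `𝓛 = 𝓛₁ ∪ ∂̄𝓛`. -/
def LSet [Fintype E] [Fintype F] (G : FlagGluing E F) (Φ : E → ℝ) : Set (F → ℝ) :=
  L₁ G Φ ∪ LBoundary G Φ

end CirclePattern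

end

open CirclePattern

noncomputable section

namespace CirclePattern

/-! ### The contribution of a side of a bigon to the total geodesic curvature -/

/-! With `k = cot r`, a side of a bigon contributes `2 s arccot (c s)`, where `s = cos r` and `c =
(y / x + cos φ) / sin φ` depends only on the quotient of the two curvatures (`halfAngle_eq`, for `x
≠ 0`). This is antitone in the neighbour's curvature and strictly increasing under a common scaling
of both curvatures (`sideCurvature_lt_scale`). Its bound `2 arccot c` is twice an angle of a
Euclidean triangle whose third angle is `π - φ`. Hence the two sides of a 1-cell together contribute
less than `2 φ` (`sideCurvature_add_lt`), and this value is approached when both curvatures tend to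
infinity (`le_sideCurvature_add`).

Summed over 1-cells, these bounds give the necessary inequalities. Injectivity is a maximum
principle for the quotient of two solutions (`le_of_curvatureMap_eq`). Existence is Perron's method
(`exists_curvatureMap_eq`). The required a priori bound (`exists_bound_of_curvatureMap_le`) holds
because 2-cells with exploding curvatures would violate the strict inequality for their union. The
same bound makes the inverse continuous. Each coordinate of the image vanishes exactly when that of
`k` does, so strata go to strata.

The geometry enters through a normal form: the radii and `φ` determine a lens up to an isometry of
the sphere (`IsLens.exists_frame`). It yields the arc lengths, hence `totalGeodesicCurvature_eq`,
and it shows that metrics with equal radii have congruent quadrilaterals, so that the identity of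
`S` is the required isometry. -/

/-- The cosine of the radius of a circle with geodesic curvature `x`. -/
def cosRadius (x : ℝ) : ℝ := x / √(1 + x ^ 2)

/-- Half of the central angle of the side, on the circle of geodesic curvature `x`, of the bigon with
interior angle `φ` between circles of geodesic curvatures `x` and `y`. -/
def halfAngle (φ x y : ℝ) : ℝ :=
  Real.pi / 2 - Real.arctan ((y + x * Real.cos φ) / (Real.sin φ * √(1 + x ^ 2)))

/-- The geodesic curvature times the length of this side. -/
def sideCurvature (φ x y : ℝ) : ℝ := 2 * (cosRadius x * halfAngle φ x y)

theorem sqrt_one_add_sq_pos (x : ℝ) : 0 < √(1 + x ^ 2) := by positivity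

theorem cosRadius_nonneg {x : ℝ} (hx : 0 ≤ x) : 0 ≤ cosRadius x := by
  unfold cosRadius; positivity

theorem cosRadius_pos {x : ℝ} (hx : 0 < x) : 0 < cosRadius x := by
  unfold cosRadius; positivity

theorem cosRadius_eq_sin_arctan (x : ℝ) : cosRadius x = Real.sin (Real.arctan x) := by
  rw [Real.sin_arctan, cosRadius]

theorem cosRadius_lt_one (x : ℝ) : cosRadius x < 1 := by
  rw [cosRadius, div_lt_one (sqrt_one_add_sq_pos x)]
  exact Real.lt_sqrt_of_sq_lt (by linarith)

theorem cosRadius_strictMono : StrictMono cosRadius := by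
  intro x y h
  rw [cosRadius_eq_sin_arctan, cosRadius_eq_sin_arctan]
  exact Real.sin_lt_sin_of_lt_of_le_pi_div_two (Real.neg_pi_div_two_lt_arctan x).le
    (Real.arctan_lt_pi_div_two y).le (Real.arctan_strictMono h)

theorem tendsto_cosRadius : Filter.Tendsto cosRadius Filter.atTop (nhds 1) := by
  have h : Filter.Tendsto (fun x => Real.sin (Real.arctan x)) Filter.atTop
      (nhds (Real.sin (Real.pi / 2))) :=
    (Real.continuous_sin.tendsto _).comp
      (Real.tendsto_arctan_atTop.mono_right nhdsWithin_le_nhds)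
  rw [Real.sin_pi_div_two] at h
  exact h.congr fun x => (cosRadius_eq_sin_arctan x).symm

theorem continuous_sideCurvature {φ : ℝ} (hφ : 0 < Real.sin φ) :
    Continuous fun p : ℝ × ℝ => sideCurvature φ p.1 p.2 := by
  unfold sideCurvature cosRadius halfAngle
  have h : ∀ p : ℝ × ℝ, √(1 + p.1 ^ 2) ≠ 0 := fun p => (sqrt_one_add_sq_pos p.1).ne'
  have h' : ∀ p : ℝ × ℝ, Real.sin φ * √(1 + p.1 ^ 2) ≠ 0 := fun p => mul_ne_zero hφ.ne' (h p)
  have h2 : Continuous fun p : ℝ × ℝ =>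
      Real.arctan ((p.2 + p.1 * Real.cos φ) / (Real.sin φ * √(1 + p.1 ^ 2))) :=
    Real.continuous_arctan.comp (Continuous.div (by fun_prop) (by fun_prop) h')
  exact continuous_const.mul ((Continuous.div (by fun_prop) (by fun_prop) h).mul
    (continuous_const.sub h2))

theorem halfAngle_pos (φ x y : ℝ) : 0 < halfAngle φ x y := by
  unfold halfAngle
  linarith [Real.arctan_lt_pi_div_two ((y + x * Real.cos φ) / (Real.sin φ * √(1 + x ^ 2)))]

theorem halfAngle_antitone {φ : ℝ} (hφ : 0 < Real.sin φ) (x : ℝ) : Antitone (halfAngle φ x) := by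
  intro y y' h
  unfold halfAngle
  have : 0 < Real.sin φ * √(1 + x ^ 2) := mul_pos hφ (sqrt_one_add_sq_pos x)
  have h2 : Real.arctan ((y + x * Real.cos φ) / (Real.sin φ * √(1 + x ^ 2))) ≤
      Real.arctan ((y' + x * Real.cos φ) / (Real.sin φ * √(1 + x ^ 2))) :=
    Real.arctan_mono (by gcongr)
  linarith

theorem sideCurvature_antitone {φ : ℝ} (hφ : 0 < Real.sin φ) {x : ℝ} (hx : 0 ≤ x) :
    Antitone (sideCurvature φ x) := fun y y' h => by
  unfold sideCurvature
  have := mul_le_mul_of_nonneg_left (halfAngle_antitone hφ x h) (cosRadius_nonneg hx)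
  linarith

theorem sideCurvature_zero_left (φ y : ℝ) : sideCurvature φ 0 y = 0 := by
  simp [sideCurvature, cosRadius]

theorem sideCurvature_pos (φ : ℝ) {x : ℝ} (hx : 0 < x) (y : ℝ) : 0 < sideCurvature φ x y :=
  mul_pos two_pos (mul_pos (cosRadius_pos hx) (halfAngle_pos φ x y))

theorem sideCurvature_nonneg (φ : ℝ) {x : ℝ} (hx : 0 ≤ x) (y : ℝ) : 0 ≤ sideCurvature φ x y :=
  mul_nonneg two_pos.le (mul_nonneg (cosRadius_nonneg hx) (halfAngle_pos φ x y).le)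

/-- With `z = cot u`, the left side is `sin u * cos u = sin (2 u) / 2`, which is less than `u`. -/
theorem div_one_add_sq_lt_pi_div_two_sub_arctan (z : ℝ) :
    z / (1 + z ^ 2) < Real.pi / 2 - Real.arctan z := by
  have h1 : z / (1 + z ^ 2) = Real.sin (Real.arctan z) * Real.cos (Real.arctan z) := by
    rw [Real.sin_arctan, Real.cos_arctan, div_mul_div_comm, Real.mul_self_sqrt (by positivity),
      mul_one]
  have h2 : Real.sin (2 * (Real.pi / 2 - Real.arctan z)) < 2 * (Real.pi / 2 - Real.arctan z) :=
    Real.sin_lt (by linarith [Real.arctan_lt_pi_div_two z])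
  rw [Real.sin_two_mul, Real.sin_pi_div_two_sub, Real.cos_pi_div_two_sub] at h2
  rw [h1]
  linarith

/-- The derivative is `arccot z - z / (1 + z ^ 2)` at `z = c * s`, positive for either sign of `c`.
-/
theorem mul_pi_div_two_sub_arctan_strictMono (c : ℝ) :
    StrictMono fun s : ℝ => s * (Real.pi / 2 - Real.arctan (c * s)) := by
  have hd : ∀ s : ℝ, HasDerivAt (fun s : ℝ => s * (Real.pi / 2 - Real.arctan (c * s)))
      (1 * (Real.pi / 2 - Real.arctan (c * s)) + s * (-(1 / (1 + (c * s) ^ 2) * (c * 1)))) s :=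
    fun s => (hasDerivAt_id' s).mul ((((hasDerivAt_id' s).const_mul c).arctan).const_sub _)
  refine strictMono_of_deriv_pos fun s => ?_
  rw [(hd s).deriv]
  have := div_one_add_sq_lt_pi_div_two_sub_arctan (c * s)
  have e : s * (-(1 / (1 + (c * s) ^ 2) * (c * 1))) = -(c * s / (1 + (c * s) ^ 2)) := by ring
  rw [e]
  linarith

/-- This form separates the scale-invariant quotient `y / x` from the factor `cosRadius x`, the only
part that a common scaling changes. -/
theorem halfAngle_eq (φ : ℝ) {x : ℝ} (hx : x ≠ 0) (y : ℝ) :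
    halfAngle φ x y =
      Real.pi / 2 - Real.arctan ((y / x + Real.cos φ) / Real.sin φ * cosRadius x) := by
  have h := (sqrt_one_add_sq_pos x).ne'
  unfold halfAngle cosRadius
  congr 2
  rw [div_mul_div_comm]
  congr 1
  field_simp

theorem sideCurvature_lt_scale (φ : ℝ) {x t : ℝ} (hx : 0 < x) (y : ℝ) (ht : 1 < t) :
    sideCurvature φ x y < sideCurvature φ (t * x) (t * y) := by
  have h0 : t ≠ 0 := by positivity
  unfold sideCurvature
  rw [halfAngle_eq φ hx.ne', halfAngle_eq φ (by positivity), mul_div_mul_left _ _ h0]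
  have := mul_pi_div_two_sub_arctan_strictMono ((y / x + Real.cos φ) / Real.sin φ)
    (cosRadius_strictMono (show x < t * x by nlinarith))
  exact mul_lt_mul_of_pos_left this two_pos

/-- The angle, in a Euclidean triangle, between the sides of the circle of curvature `x` and the
line of centers. -/
def euclHalfAngle (φ x y : ℝ) : ℝ :=
  Real.pi / 2 - Real.arctan ((y / x + Real.cos φ) / Real.sin φ)

/-- The right side is the value at `s = 1` of the increasing function `2 s arccot (c s)`, and
`cosRadius x < 1`. -/
theorem sideCurvature_lt_euclHalfAngle (φ : ℝ) {x : ℝ} (hx : 0 < x) (y : ℝ) :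
    sideCurvature φ x y < 2 * euclHalfAngle φ x y := by
  unfold sideCurvature euclHalfAngle
  rw [halfAngle_eq φ hx.ne']
  have := mul_pi_div_two_sub_arctan_strictMono ((y / x + Real.cos φ) / Real.sin φ)
    (cosRadius_lt_one x)
  simp only [one_mul, mul_one] at this
  linarith

theorem euclHalfAngle_le_halfAngle {φ : ℝ} (hφ : 0 < Real.sin φ) (hc : 0 ≤ Real.cos φ) {x y : ℝ}
    (hx : 0 < x) (hy : 0 ≤ y) : euclHalfAngle φ x y ≤ halfAngle φ x y := by
  rw [halfAngle_eq φ hx.ne', euclHalfAngle]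
  have h : 0 ≤ (y / x + Real.cos φ) / Real.sin φ := by positivity
  have := Real.arctan_mono (mul_le_of_le_one_right h (cosRadius_lt_one x).le)
  linarith

theorem arctan_cot {φ : ℝ} (h0 : 0 < φ) (h1 : φ < Real.pi) :
    Real.arctan (Real.cos φ / Real.sin φ) = Real.pi / 2 - φ := by
  rw [← Real.cos_pi_div_two_sub φ, ← Real.sin_pi_div_two_sub φ, ← Real.tan_eq_sin_div_cos]
  exact Real.arctan_tan (by linarith) (by linarith)

theorem euclHalfAngle_zero {φ : ℝ} (h0 : 0 < φ) (h1 : φ < Real.pi) (x : ℝ) :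
    euclHalfAngle φ x 0 = φ := by
  rw [euclHalfAngle, zero_div, zero_add, arctan_cot h0 h1]
  ring

/-- Addition formula of the cotangent. Positivity of `a` and `b` keeps the sum of the two angles in
`(0, π)`, where arccot inverts cot. -/
theorem pi_div_two_sub_arctan_add {a b : ℝ} (ha : 0 < a) (hb : 0 < b) :
    Real.pi / 2 - Real.arctan a + (Real.pi / 2 - Real.arctan b) =
      Real.pi / 2 - Real.arctan ((a * b - 1) / (a + b)) := by
  set u := Real.pi / 2 - Real.arctan a + (Real.pi / 2 - Real.arctan b) with hu
  have ha1 := Real.arctan_pos.2 ha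
  have hb1 := Real.arctan_pos.2 hb
  have ha2 := Real.arctan_lt_pi_div_two a
  have hb2 := Real.arctan_lt_pi_div_two b
  have hc : Real.cos u / Real.sin u = (a * b - 1) / (a + b) := by
    have e1 : u = Real.pi - (Real.arctan a + Real.arctan b) := by rw [hu]; ring
    have p1 := sqrt_one_add_sq_pos a
    have p2 := sqrt_one_add_sq_pos b
    rw [e1, Real.cos_pi_sub, Real.sin_pi_sub, Real.cos_add, Real.sin_add, Real.sin_arctan,
      Real.cos_arctan, Real.sin_arctan, Real.cos_arctan]
    have q : a + b ≠ 0 := by positivity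
    field_simp
    ring
  rw [← hc, arctan_cot (by linarith) (by linarith)]
  ring

/-- Angle sum of the Euclidean triangle with sides `1 / x` and `1 / y` enclosing the angle `π - φ`.
In the cotangent formula everything cancels to `cot φ` because `(y / x) * (x / y) = 1`. -/
theorem euclHalfAngle_add {φ : ℝ} (h0 : 0 < φ) (h1 : φ < Real.pi) (hc : 0 ≤ Real.cos φ) {x y : ℝ}
    (hx : 0 < x) (hy : 0 < y) : euclHalfAngle φ x y + euclHalfAngle φ y x = φ := by
  have hs : 0 < Real.sin φ := Real.sin_pos_of_pos_of_lt_pi h0 h1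
  unfold euclHalfAngle
  rw [pi_div_two_sub_arctan_add (by positivity) (by positivity)]
  have e : ((y / x + Real.cos φ) / Real.sin φ * ((x / y + Real.cos φ) / Real.sin φ) - 1) /
      ((y / x + Real.cos φ) / Real.sin φ + (x / y + Real.cos φ) / Real.sin φ) =
      Real.cos φ / Real.sin φ := by
    have q : 0 < y / x + Real.cos φ + (x / y + Real.cos φ) := by positivity
    rw [← add_div, div_div_eq_mul_div, div_eq_div_iff q.ne' hs.ne']
    have h2 := Real.sin_sq_add_cos_sq φ
    have h3 : y / x * (x / y) = 1 := by field_simp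
    generalize y / x = u at *
    generalize x / y = v at *
    have h4 : (u + Real.cos φ) / Real.sin φ * ((v + Real.cos φ) / Real.sin φ) - 1 =
        ((u + Real.cos φ) * (v + Real.cos φ) - Real.sin φ ^ 2) / Real.sin φ ^ 2 := by
      field_simp
    rw [h4]
    field_simp
    linear_combination h3 - h2
  rw [e, arctan_cot h0 h1]
  ring

theorem sideCurvature_lt {φ : ℝ} (h0 : 0 < φ) (h1 : φ < Real.pi) {x y : ℝ} (hx : 0 ≤ x)
    (hy : 0 ≤ y) : sideCurvature φ x y < 2 * φ := by
  rcases hx.eq_or_lt with rfl | hx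
  · rw [sideCurvature_zero_left]; positivity
  · refine (sideCurvature_antitone (Real.sin_pos_of_pos_of_lt_pi h0 h1) hx.le hy).trans_lt ?_
    have := sideCurvature_lt_euclHalfAngle φ hx 0
    rwa [euclHalfAngle_zero h0 h1] at this

theorem sideCurvature_add_lt {φ : ℝ} (h0 : 0 < φ) (h1 : φ < Real.pi) (hc : 0 ≤ Real.cos φ)
    {x y : ℝ} (hx : 0 ≤ x) (hy : 0 ≤ y) :
    sideCurvature φ x y + sideCurvature φ y x < 2 * φ := by
  rcases hx.eq_or_lt with rfl | hx
  · rw [sideCurvature_zero_left, zero_add]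
    exact sideCurvature_lt h0 h1 hy le_rfl
  rcases hy.eq_or_lt with rfl | hy
  · rw [sideCurvature_zero_left, add_zero]
    exact sideCurvature_lt h0 h1 hx.le le_rfl
  have := sideCurvature_lt_euclHalfAngle φ hx y
  have := sideCurvature_lt_euclHalfAngle φ hy x
  have := euclHalfAngle_add h0 h1 hc hx hy
  linarith

/-- Spherical half angles dominate the Euclidean ones, which add up to `φ`. The bound is uniform in
the quotient `y / x`, so no control of relative growth is needed when both curvatures tend to
infinity. -/
theorem le_sideCurvature_add {φ : ℝ} (h0 : 0 < φ) (h1 : φ < Real.pi) (hc : 0 ≤ Real.cos φ)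
    {m x y : ℝ} (hm : 0 < m) (hx : m ≤ x) (hy : m ≤ y) :
    cosRadius m * (2 * φ) ≤ sideCurvature φ x y + sideCurvature φ y x := by
  have hs : 0 < Real.sin φ := Real.sin_pos_of_pos_of_lt_pi h0 h1
  have hx0 := hm.trans_le hx
  have hy0 := hm.trans_le hy
  have e := euclHalfAngle_add h0 h1 hc hx0 hy0
  have a1 := euclHalfAngle_le_halfAngle hs hc hx0 hy0.le
  have a2 := euclHalfAngle_le_halfAngle hs hc hy0 hx0.le
  have b1 := mul_le_mul_of_nonneg_right (cosRadius_strictMono.monotone hx)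
    (halfAngle_pos φ x y).le
  have b2 := mul_le_mul_of_nonneg_right (cosRadius_strictMono.monotone hy)
    (halfAngle_pos φ y x).le
  have d := mul_le_mul_of_nonneg_left (add_le_add a1 a2) (cosRadius_pos hm).le
  rw [e] at d
  unfold sideCurvature
  linarith

/-- For fixed `y` the quotient `y / x` tends to `0`, so the half angle tends to `arccot (cot φ)`. -/
theorem tendsto_sideCurvature {φ : ℝ} (h0 : 0 < φ) (h1 : φ < Real.pi) (y : ℝ) :
    Filter.Tendsto (fun x => sideCurvature φ x y) Filter.atTop (nhds (2 * φ)) := by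
  have hs : 0 < Real.sin φ := Real.sin_pos_of_pos_of_lt_pi h0 h1
  have h : Filter.Tendsto (fun x => (y / x + Real.cos φ) / Real.sin φ * cosRadius x)
      Filter.atTop (nhds ((0 + Real.cos φ) / Real.sin φ * 1)) :=
    ((((Filter.tendsto_id).const_div_atTop y).add_const _).div_const _).mul tendsto_cosRadius
  have h2 := ((tendsto_cosRadius.mul
    (((Real.continuous_arctan.tendsto _).comp h).const_sub (Real.pi / 2))).const_mul 2)
  rw [mul_one, zero_add, arctan_cot h0 h1, sub_sub_cancel, one_mul] at h2
  refine h2.congr' ?_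
  filter_upwards [Filter.eventually_gt_atTop 0] with x hx
  rw [sideCurvature, halfAngle_eq φ hx.ne']
  rfl

section

/-! ### The curvature map -/

variable {E F : Type*}

open scoped Classical in
/-- The total geodesic curvature as a function of the geodesic curvatures. -/
def curvatureMap [Fintype E] (G : FlagGluing E F) (Φ : E → ℝ) (k : F → ℝ) (f : F) : ℝ :=
  ∑ s : E × Bool with G.sideFace s.1 s.2 = f,
    sideCurvature (Φ s.1) (k f) (k (G.sideFace s.1 (!s.2)))

open scoped Classical in
/-- The contribution of a 1-cell to the sum of the total geodesic curvatures of the 2-cells in `F'`. -/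
def edgeCurvature (G : FlagGluing E F) (Φ : E → ℝ) (k : F → ℝ) (F' : Finset F) (e : E) : ℝ :=
  ∑ b : Bool, if G.sideFace e b ∈ F' then
    sideCurvature (Φ e) (k (G.sideFace e b)) (k (G.sideFace e (!b))) else 0

theorem FlagGluing.mem_edgesOf [Fintype E] (G : FlagGluing E F) (F' : Finset F) (e : E) :
    e ∈ G.edgesOf F' ↔ ∃ b, G.sideFace e b ∈ F' := by
  simp [FlagGluing.edgesOf]

theorem FlagGluing.edgesOf_mono [Fintype E] (G : FlagGluing E F) {F₁ F₂ : Finset F}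
    (h : F₁ ⊆ F₂) : G.edgesOf F₁ ⊆ G.edgesOf F₂ := fun e he => by
  rw [FlagGluing.mem_edgesOf] at he ⊢
  exact he.imp fun b hb => h hb

theorem FlagGluing.exists_sideFace_eq (G : FlagGluing E F) (f : F) : ∃ e b, G.sideFace e b = f := by
  obtain ⟨⟨e, b, h⟩, rfl⟩ := G.face_surjective f
  refine ⟨e, b, ?_⟩
  cases h
  · rfl
  · exact (G.face_eq_iff _ _).2 (.rel _ _ (Or.inl rfl))

theorem FlagGluing.edgesOf_nonempty [Fintype E] (G : FlagGluing E F) {F' : Finset F}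
    (h : F'.Nonempty) : (G.edgesOf F').Nonempty := by
  obtain ⟨f, hf⟩ := h
  obtain ⟨e, b, rfl⟩ := G.exists_sideFace_eq f
  exact ⟨e, (G.mem_edgesOf _ _).2 ⟨b, hf⟩⟩

/-- Double counting of the sides of 1-cells: grouped by 2-cell on the left, by 1-cell on the right.
-/
theorem sum_curvatureMap [Fintype E] (G : FlagGluing E F) (Φ : E → ℝ) (k : F → ℝ)
    (F' : Finset F) :
    ∑ f ∈ F', curvatureMap G Φ k f = ∑ e ∈ G.edgesOf F', edgeCurvature G Φ k F' e := by
  classical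
  have h1 : ∑ e ∈ G.edgesOf F', edgeCurvature G Φ k F' e = ∑ e, edgeCurvature G Φ k F' e := by
    refine Finset.sum_subset (Finset.subset_univ _) fun e _ he => ?_
    rw [FlagGluing.mem_edgesOf, not_exists] at he
    exact Finset.sum_eq_zero fun b _ => if_neg (he b)
  rw [h1]
  unfold edgeCurvature curvatureMap
  rw [← Fintype.sum_prod_type' fun (e : E) (b : Bool) => if G.sideFace e b ∈ F' then
    sideCurvature (Φ e) (k (G.sideFace e b)) (k (G.sideFace e (!b))) else 0]
  simp_rw [Finset.sum_filter]
  rw [Finset.sum_comm]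
  refine Finset.sum_congr rfl fun s _ => ?_
  exact Finset.sum_ite_eq F' (G.sideFace s.1 s.2)
    fun f => sideCurvature (Φ s.1) (k f) (k (G.sideFace s.1 (!s.2)))

/-! ### Maximum principle, properness and Perron's method. -/

section

variable [Fintype E] (G : FlagGluing E F) {Φ : E → ℝ}

theorem sin_pos_of_mem_Ioo {φ : ℝ} (h : φ ∈ Set.Ioo 0 (Real.pi / 2)) : 0 < Real.sin φ :=
  Real.sin_pos_of_pos_of_lt_pi h.1 (by linarith [h.1, h.2])

theorem cos_pos_of_mem_Ioo {φ : ℝ} (h : φ ∈ Set.Ioo 0 (Real.pi / 2)) : 0 < Real.cos φ :=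
  Real.cos_pos_of_mem_Ioo ⟨by linarith [h.1, h.2], h.2⟩

theorem continuous_curvatureMap (hΦ : ∀ e, Φ e ∈ Set.Ioo 0 (Real.pi / 2)) :
    Continuous (curvatureMap G Φ) := by
  refine continuous_pi fun f => ?_
  unfold curvatureMap
  refine continuous_finsetSum _ fun s _ => ?_
  have h : Continuous fun k : F → ℝ => (k f, k (G.sideFace s.1 (!s.2))) :=
    (continuous_apply f).prodMk (continuous_apply _)
  exact (continuous_sideCurvature (sin_pos_of_mem_Ioo (hΦ s.1))).comp h

theorem curvatureMap_nonneg {k : F → ℝ} (f : F) (hk : 0 ≤ k f) : 0 ≤ curvatureMap G Φ k f :=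
  Finset.sum_nonneg fun _ _ => sideCurvature_nonneg _ hk _

theorem curvatureMap_eq_zero {k : F → ℝ} {f : F} (hk : k f = 0) : curvatureMap G Φ k f = 0 :=
  Finset.sum_eq_zero fun s _ => by rw [hk, sideCurvature_zero_left]

open scoped Classical in
theorem sides_nonempty (f : F) :
    (Finset.univ.filter fun s : E × Bool => G.sideFace s.1 s.2 = f).Nonempty := by
  obtain ⟨e, b, h⟩ := G.exists_sideFace_eq f
  exact ⟨(e, b), by simpa using h⟩

theorem curvatureMap_pos {k : F → ℝ} {f : F} (hk : 0 < k f) : 0 < curvatureMap G Φ k f :=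
  Finset.sum_pos (fun _ _ => sideCurvature_pos _ hk _) (sides_nonempty G f)

theorem curvatureMap_pos_iff {k : F → ℝ} {f : F} (hk : 0 ≤ k f) :
    0 < curvatureMap G Φ k f ↔ 0 < k f := by
  refine ⟨fun h => hk.lt_of_ne fun h0 => ?_, curvatureMap_pos G⟩
  rw [curvatureMap_eq_zero G h0.symm] at h
  exact lt_irrefl _ h

/-- Only neighbours other than `f` can change; where `f` is its own neighbour, the equality at `f`
leaves the term unchanged. -/
theorem curvatureMap_le_of_le (hΦ : ∀ e, Φ e ∈ Set.Ioo 0 (Real.pi / 2)) {k k' : F → ℝ} {f : F}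
    (h0 : 0 ≤ k f) (hf : k f = k' f) (h : ∀ g, k g ≤ k' g) :
    curvatureMap G Φ k' f ≤ curvatureMap G Φ k f := by
  unfold curvatureMap
  rw [← hf]
  exact Finset.sum_le_sum fun s _ =>
    sideCurvature_antitone (sin_pos_of_mem_Ioo (hΦ s.1)) h0 (h _)

theorem curvatureMap_lt_scale {k : F → ℝ} {f : F} (hf : 0 < k f) {t : ℝ} (ht : 1 < t) :
    curvatureMap G Φ k f < curvatureMap G Φ (fun g => t * k g) f :=
  Finset.sum_lt_sum_of_nonempty (sides_nonempty G f)
    fun _ _ => sideCurvature_lt_scale _ hf _ ht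

/-- Maximum principle: the largest quotient of corresponding geodesic curvatures is at most `1` if the
total geodesic curvatures agree. -/
theorem le_of_curvatureMap_eq [Fintype F] (hΦ : ∀ e, Φ e ∈ Set.Ioo 0 (Real.pi / 2)) {k k' : F → ℝ}
    (hk : ∀ f, 0 ≤ k f) (hk' : ∀ f, 0 ≤ k' f) (h : curvatureMap G Φ k = curvatureMap G Φ k')
    (f : F) : k' f ≤ k f := by
  classical
  have hpos : ∀ g, 0 < k g ↔ 0 < k' g := fun g => by
    rw [← curvatureMap_pos_iff G (Φ := Φ) (hk g), ← curvatureMap_pos_iff G (Φ := Φ) (hk' g), h]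
  by_contra! hlt
  have hf : 0 < k f := (hpos f).2 ((hk f).trans_lt hlt)
  -- At a maximum `m` of the quotient, `k'` touches `t * k` from below. Scaling strictly raises the
  -- value at `m`, and lowering the neighbours from `t * k` to `k'` cannot decrease it, so the two
  -- totals differ at `m`.
  obtain ⟨m, hm, hmax⟩ := Finset.exists_max_image (Finset.univ.filter fun g => 0 < k g)
    (fun g => k' g / k g) ⟨f, by simpa using hf⟩
  simp only [Finset.mem_filter, Finset.mem_univ, true_and] at hm hmax
  set t := k' m / k m with ht
  have ht1 : 1 < t := ((one_lt_div hf).2 hlt).trans_le (hmax f hf)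
  have hle : ∀ g, k' g ≤ t * k g := fun g => by
    rcases (hk g).eq_or_lt with h0 | h0
    · have : ¬ 0 < k' g := fun h1 => h0.not_lt ((hpos g).2 h1)
      rw [← h0, mul_zero]
      exact not_lt.1 this
    · exact (div_le_iff₀ h0).1 (hmax g h0)
  have heq : k' m = t * k m := by rw [ht, div_mul_cancel₀ _ hm.ne']
  have h1 := curvatureMap_lt_scale G (Φ := Φ) hm ht1
  have h2 := curvatureMap_le_of_le G hΦ (k' := fun g => t * k g) (hk' m) heq hle
  rw [h] at h1
  exact absurd h1 h2.not_gt

theorem curvatureMap_injOn [Fintype F] (hΦ : ∀ e, Φ e ∈ Set.Ioo 0 (Real.pi / 2)) :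
    Set.InjOn (curvatureMap G Φ) {k | ∀ f, 0 ≤ k f} := fun _ hk _ hk' h =>
  funext fun f => le_antisymm (le_of_curvatureMap_eq G hΦ hk' hk h.symm f)
    (le_of_curvatureMap_eq G hΦ hk hk' h f)

theorem sum_curvatureMap_lt (hΦ : ∀ e, Φ e ∈ Set.Ioo 0 (Real.pi / 2)) {k : F → ℝ}
    (hk : ∀ f, 0 ≤ k f) {F' : Finset F} (hF' : F'.Nonempty) :
    ∑ f ∈ F', curvatureMap G Φ k f < 2 * ∑ e ∈ G.edgesOf F', Φ e := by
  rw [sum_curvatureMap, Finset.mul_sum]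
  refine Finset.sum_lt_sum_of_nonempty (G.edgesOf_nonempty hF') fun e _ => ?_
  have h0 := (hΦ e).1
  have h1 : Φ e < Real.pi := by linarith [(hΦ e).1, (hΦ e).2]
  unfold edgeCurvature
  rw [Fintype.sum_bool]
  split_ifs
  · exact sideCurvature_add_lt h0 h1 (cos_pos_of_mem_Ioo (hΦ e)).le (hk _) (hk _)
  · rw [add_zero]; exact sideCurvature_lt h0 h1 (hk _) (hk _)
  · rw [zero_add]; exact sideCurvature_lt h0 h1 (hk _) (hk _)
  · linarith

/-- If along an ultrafilter the geodesic curvatures of the 2-cells in `F'` tend to infinity and the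
others stay bounded, then the contribution of a 1-cell of `F'` is at least `2 Φ e` in the limit. -/
theorem eventually_le_edgeCurvature (hΦ : ∀ e, Φ e ∈ Set.Ioo 0 (Real.pi / 2)) {α : Type*}
    {l : Filter α} {k : α → F → ℝ} (hk : ∀ n f, 0 ≤ k n f) {F' : Finset F}
    (hF : ∀ f ∈ F', Filter.Tendsto (fun n => k n f) l Filter.atTop)
    (hF' : ∀ f ∉ F', ∃ M, ∀ᶠ n in l, k n f ≤ M) {e : E} (he : e ∈ G.edgesOf F') {c : ℝ}
    (hc : c < 2 * Φ e) : ∀ᶠ n in l, c ≤ edgeCurvature G Φ (k n) F' e := by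
  have h0 := (hΦ e).1
  have h1 : Φ e < Real.pi := by linarith [(hΦ e).1, (hΦ e).2]
  have hone : ∀ b, G.sideFace e b ∈ F' → G.sideFace e (!b) ∉ F' → ∀ᶠ n in l, c ≤
      sideCurvature (Φ e) (k n (G.sideFace e b)) (k n (G.sideFace e (!b))) := by
    intro b hb hb'
    obtain ⟨M, hM⟩ := hF' _ hb'
    filter_upwards [hM, ((tendsto_sideCurvature h0 h1 M).comp (hF _ hb)).eventually_const_lt hc]
      with n h2 h3
    exact h3.le.trans (sideCurvature_antitone (sin_pos_of_mem_Ioo (hΦ e)) (hk n _) h2)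
  rw [FlagGluing.mem_edgesOf] at he
  simp only [edgeCurvature, Fintype.sum_bool, Bool.not_true, Bool.not_false]
  by_cases ht : G.sideFace e true ∈ F' <;> by_cases hf : G.sideFace e false ∈ F'
  · have hlim : Filter.Tendsto (fun m => cosRadius m * (2 * Φ e)) Filter.atTop
        (nhds (1 * (2 * Φ e))) := tendsto_cosRadius.mul_const _
    rw [one_mul] at hlim
    obtain ⟨m, hm, hm0⟩ := ((hlim.eventually_const_lt hc).and
      (Filter.eventually_gt_atTop 0)).exists
    filter_upwards [(hF _ ht).eventually_ge_atTop m, (hF _ hf).eventually_ge_atTop m] with n h2 h3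
    rw [if_pos ht, if_pos hf]
    exact hm.le.trans (le_sideCurvature_add h0 h1 (cos_pos_of_mem_Ioo (hΦ e)).le hm0 h2 h3)
  · simpa [ht, hf] using hone true ht hf
  · simpa [ht, hf] using hone false hf ht
  · obtain ⟨b, hb⟩ := he
    cases b
    · exact absurd hb hf
    · exact absurd hb ht

/-- Properness of the curvature map, in a form for subsolutions. -/
theorem exists_bound_of_curvatureMap_le [Fintype F] (hΦ : ∀ e, Φ e ∈ Set.Ioo 0 (Real.pi / 2))
    {L : F → ℝ} (hL : ∀ F' : Finset F, F'.Nonempty →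
      ∑ f ∈ F', L f < 2 * ∑ e ∈ G.edgesOf F', Φ e) :
    ∃ M ε : ℝ, 0 < ε ∧ ∀ k : F → ℝ, (∀ f, 0 ≤ k f) →
      (∀ f, curvatureMap G Φ k f ≤ L f + ε) → ∀ f, k f ≤ M := by
  classical
  by_contra! hcon
  -- A failure of the claim for `M = n` and `ε = 1 / (n + 1)` gives a sequence with an unbounded
  -- coordinate.
  choose k hk hkL f₀ hf₀ using fun n : ℕ => hcon n (1 / (n + 1 : ℝ)) (by positivity)
  -- Along an ultrafilter each coordinate either tends to infinity or is eventually bounded, which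
  -- replaces the passage to subsequences.
  let U : Filter ℕ := Filter.hyperfilter ℕ
  have hU : U ≤ Filter.atTop := by
    rw [← Nat.cofinite_eq_atTop]; exact Filter.hyperfilter_le_cofinite
  let F' : Finset F := Finset.univ.filter fun f => Filter.Tendsto (fun n => k n f) U Filter.atTop
  have hF : ∀ f ∈ F', Filter.Tendsto (fun n => k n f) U Filter.atTop := fun f hf =>
    (Finset.mem_filter.1 hf).2
  have hF' : ∀ f ∉ F', ∃ M, ∀ᶠ n in U, k n f ≤ M := fun f hf => by
    have : ¬ Filter.Tendsto (fun n => k n f) U Filter.atTop := by simpa [F'] using hf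
    rw [Filter.tendsto_atTop] at this
    push Not at this
    obtain ⟨M, hM⟩ := this
    refine ⟨M, ?_⟩
    exact ((Ultrafilter.frequently_iff_eventually (f := Filter.hyperfilter ℕ)).1 hM).mono
      fun n hn => hn.le
  have hne : F'.Nonempty := by
    by_contra hemp
    rw [Finset.not_nonempty_iff_eq_empty] at hemp
    choose M hM using fun f => hF' f (by rw [hemp]; exact Finset.notMem_empty f)
    have h1 : ∀ᶠ n in U, ∀ f, k n f ≤ M f := Filter.eventually_all.2 hM
    have h2 : ∀ᶠ n : ℕ in U, ∑ f, |M f| ≤ (n : ℝ) :=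
      hU ((tendsto_natCast_atTop_atTop (R := ℝ)).eventually_ge_atTop _)
    obtain ⟨n, hn1, hn2⟩ := (h1.and h2).exists
    have h3 := Finset.single_le_sum (f := fun f => |M f|) (fun f _ => abs_nonneg _)
      (Finset.mem_univ (f₀ n))
    have h4 := le_abs_self (M (f₀ n))
    have := hf₀ n
    have := hn1 (f₀ n)
    linarith
  have key : ∀ c : E → ℝ, (∀ e, c e < 2 * Φ e) → ∑ e ∈ G.edgesOf F', c e ≤ ∑ f ∈ F', L f := by
    intro c hc
    have h1 : ∀ᶠ n in U, ∀ e ∈ G.edgesOf F', c e ≤ edgeCurvature G Φ (k n) F' e :=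
      (Filter.eventually_all_finset _).2 fun e he =>
        eventually_le_edgeCurvature G hΦ hk hF hF' he (hc e)
    have hlim : Filter.Tendsto (fun n : ℕ => ∑ f ∈ F', (L f + 1 / (n + 1 : ℝ))) U
        (nhds (∑ f ∈ F', (L f + 0))) :=
      tendsto_finsetSum _ fun f _ =>
        (tendsto_const_nhds.add tendsto_one_div_add_atTop_nhds_zero_nat).mono_left hU
    simp only [add_zero] at hlim
    refine ge_of_tendsto hlim (h1.mono fun n hn => ?_)
    exact (Finset.sum_le_sum hn).trans ((sum_curvatureMap G Φ (k n) F').symm.le.trans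
      (Finset.sum_le_sum fun f _ => hkL n f))
  -- The bounds on single 1-cells hold only strictly below `2 * Φ e`; letting `δ` tend to `0`
  -- recovers the full sum and contradicts `hL`.
  have hlim : Filter.Tendsto (fun δ : ℝ => ∑ e ∈ G.edgesOf F', (2 * Φ e - δ))
      (nhdsWithin 0 (Set.Ioi 0)) (nhds (∑ e ∈ G.edgesOf F', (2 * Φ e - 0))) :=
    tendsto_finsetSum _ fun e _ =>
      (tendsto_const_nhds.sub Filter.tendsto_id).mono_left nhdsWithin_le_nhds
  have hle := le_of_tendsto hlim (by
    filter_upwards [self_mem_nhdsWithin] with δ hδ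
    exact key (fun e => 2 * Φ e - δ) fun e => sub_lt_self _ hδ)
  simp only [sub_zero, ← Finset.mul_sum] at hle
  exact absurd hle (hL F' hne).not_ge

/-- Perron's method: the supremum of the subsolutions is a solution. -/
theorem exists_curvatureMap_eq [Fintype F] (hΦ : ∀ e, Φ e ∈ Set.Ioo 0 (Real.pi / 2))
    {L : F → ℝ} (h0 : ∀ f, 0 ≤ L f) (hL : ∀ F' : Finset F, F'.Nonempty →
      ∑ f ∈ F', L f < 2 * ∑ e ∈ G.edgesOf F', Φ e) :
    ∃ k : F → ℝ, (∀ f, 0 ≤ k f) ∧ curvatureMap G Φ k = L := by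
  classical
  obtain ⟨M, ε, hε, hM⟩ := exists_bound_of_curvatureMap_le G hΦ hL
  let A : Set (F → ℝ) := {k | (∀ f, 0 ≤ k f) ∧ ∀ f, curvatureMap G Φ k f ≤ L f}
  have hA0 : (0 : F → ℝ) ∈ A :=
    ⟨fun _ => le_rfl, fun f => (curvatureMap_eq_zero G (k := 0) rfl).trans_le (h0 f)⟩
  have hbdd : ∀ f, BddAbove ((fun k : F → ℝ => k f) '' A) := fun f =>
    ⟨M, by rintro _ ⟨k, hk, rfl⟩; exact hM k hk.1 (fun g => (hk.2 g).trans (by linarith)) f⟩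
  let K : F → ℝ := fun f => sSup ((fun k : F → ℝ => k f) '' A)
  have hle : ∀ k ∈ A, ∀ f, k f ≤ K f := fun k hk f => le_csSup (hbdd f) ⟨k, hk, rfl⟩
  have hK0 : ∀ f, 0 ≤ K f := hle 0 hA0
  have hcont : ∀ f, Continuous fun x => curvatureMap G Φ (Function.update K f x) f := fun f =>
    (continuous_apply f).comp
      ((continuous_curvatureMap G hΦ).comp (continuous_const.update f continuous_id))
  have hKA : K ∈ A := by
    -- For `k ∈ A`, moving all coordinates but `f` up to `K` lowers the total at `f`. Hence the
    -- inequality holds at `K` with coordinate `f` replaced by `k f`, and it passes to the supremum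
    -- of these values by closedness.
    refine ⟨hK0, fun f => ?_⟩
    have hclos : IsClosed {x | curvatureMap G Φ (Function.update K f x) f ≤ L f} :=
      isClosed_le (hcont f) continuous_const
    have hmem : K f ∈ {x | curvatureMap G Φ (Function.update K f x) f ≤ L f} := by
      refine hclos.closure_subset_iff.2 ?_ (csSup_mem_closure ⟨_, 0, hA0, rfl⟩ (hbdd f))
      rintro _ ⟨k, hk, rfl⟩
      refine (curvatureMap_le_of_le G hΦ (hk.1 f) (by simp) fun g => ?_).trans (hk.2 f)
      rcases eq_or_ne g f with rfl | hg
      · simp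
      · simpa [hg] using hle k hk g
    simpa using hmem
  refine ⟨K, hK0, funext fun f => le_antisymm (hKA.2 f) ?_⟩
  by_contra! hlt
  -- If the inequality is strict at `f`, coordinate `f` can be raised slightly: the other totals
  -- only decrease, so the result is a subsolution that exceeds the supremum.
  have hev : ∀ᶠ x in nhds (K f), curvatureMap G Φ (Function.update K f x) f < L f := by
    have h1 := (hcont f).tendsto (K f)
    simp only [Function.update_eq_self] at h1
    exact h1.eventually_lt_const hlt
  obtain ⟨x, hx, hxK⟩ := ((hev.filter_mono nhdsWithin_le_nhds).and
    (self_mem_nhdsWithin (s := Set.Ioi (K f)))).exists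
  have hxK : K f < x := hxK
  have hmem : Function.update K f x ∈ A := by
    have hge : ∀ g, K g ≤ Function.update K f x g := fun g => by
      rcases eq_or_ne g f with rfl | hg
      · simpa using hxK.le
      · simp [hg]
    refine ⟨fun g => (hK0 g).trans (hge g), fun g => ?_⟩
    rcases eq_or_ne g f with rfl | hg
    · exact hx.le
    · exact (curvatureMap_le_of_le G hΦ (hK0 g) (by simp [hg]) hge).trans (hKA.2 g)
  have := hle _ hmem f
  simp only [Function.update_self] at this
  linarith

end

/-! ### The set of total geodesic curvatures -/

theorem orthantStratum_nonneg {I : Finset F} {k : F → ℝ} (h : k ∈ orthantStratum I) (f : F) :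
    0 ≤ k f := by
  by_cases hf : f ∈ I
  · exact (h.1 f hf).le
  · exact (h.2 f hf).ge

theorem L₁_eq_LStratum [Fintype E] [Fintype F] (G : FlagGluing E F) (Φ : E → ℝ) :
    L₁ G Φ = LStratum G Φ Finset.univ := by
  ext L
  simp [L₁, LStratum, orthantStratum]

/-- The inequality for `F'` follows from the one for `F' ∩ I`: `L` vanishes off `I`, and the right
side is monotone in the set. Thus all strata share the same inequalities. -/
theorem LStratum_eq [Fintype E] (G : FlagGluing E F) {Φ : E → ℝ}
    (hΦ : ∀ e, Φ e ∈ Set.Ioo 0 (Real.pi / 2)) (I : Finset F) :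
    LStratum G Φ I = orthantStratum I ∩ {L | ∀ F' : Finset F, F'.Nonempty →
      ∑ f ∈ F', L f < 2 * ∑ e ∈ G.edgesOf F', Φ e} := by
  classical
  ext L
  refine ⟨fun h => ⟨h.1, fun F' hF' => ?_⟩, fun h => ⟨h.1, fun F' _ hF' => h.2 F' hF'⟩⟩
  have h1 : ∑ f ∈ F', L f = ∑ f ∈ F' ∩ I, L f := by
    refine (Finset.sum_subset Finset.inter_subset_left fun f hf hfI => h.1.2 f fun h2 => ?_).symm
    exact hfI (Finset.mem_inter.2 ⟨hf, h2⟩)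
  rw [h1]
  rcases (F' ∩ I).eq_empty_or_nonempty with h2 | h2
  · rw [h2, Finset.sum_empty]
    exact mul_pos two_pos (Finset.sum_pos (fun e _ => (hΦ e).1) (G.edgesOf_nonempty hF'))
  · refine (h.2 _ Finset.inter_subset_right h2).trans_le ?_
    exact mul_le_mul_of_nonneg_left (Finset.sum_le_sum_of_subset_of_nonneg
      (G.edgesOf_mono Finset.inter_subset_left) fun e _ _ => (hΦ e).1.le) two_pos.le

theorem LStratum_empty [Fintype E] (G : FlagGluing E F) (Φ : E → ℝ) :
    LStratum G Φ ∅ = {0} := by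
  ext L
  simp only [LStratum, orthantStratum, Set.mem_ofPred_eq, Set.mem_singleton_iff]
  refine ⟨fun h => funext fun f => h.1.2 f (Finset.notMem_empty f), ?_⟩
  rintro rfl
  refine ⟨by simp, fun F' h h' => ?_⟩
  rw [Finset.subset_empty.1 h] at h'
  exact absurd h' Finset.not_nonempty_empty

/-- The support of `L` selects its stratum, with `{0}` as the stratum of the empty set. -/
theorem mem_LSet_iff [Fintype E] [Fintype F] (G : FlagGluing E F) {Φ : E → ℝ}
    (hΦ : ∀ e, Φ e ∈ Set.Ioo 0 (Real.pi / 2)) (L : F → ℝ) :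
    L ∈ LSet G Φ ↔ (∀ f, 0 ≤ L f) ∧ ∀ F' : Finset F, F'.Nonempty →
      ∑ f ∈ F', L f < 2 * ∑ e ∈ G.edgesOf F', Φ e := by
  classical
  have hS : L ∈ LSet G Φ ↔ ∃ I, L ∈ LStratum G Φ I := by
    simp only [LSet, LBoundary, L₁_eq_LStratum, ← LStratum_empty G Φ, Set.mem_union,
      Set.mem_iUnion]
    constructor
    · rintro (h | ⟨I, -, -, h⟩ | h)
      exacts [⟨_, h⟩, ⟨_, h⟩, ⟨_, h⟩]
    · rintro ⟨I, h⟩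
      by_cases h1 : I = Finset.univ
      · exact Or.inl (h1 ▸ h)
      rcases I.eq_empty_or_nonempty with h2 | h2
      · exact Or.inr (Or.inr (h2 ▸ h))
      · exact Or.inr (Or.inl ⟨I, h2, h1, h⟩)
  rw [hS]
  simp only [LStratum_eq G hΦ]
  constructor
  · rintro ⟨I, h1, h2⟩
    exact ⟨orthantStratum_nonneg h1, h2⟩
  · rintro ⟨h1, h2⟩
    refine ⟨Finset.univ.filter fun f => 0 < L f, ⟨fun f hf => by simpa using hf, fun f hf => ?_⟩, h2⟩
    exact le_antisymm (by simpa using hf) (h1 f)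

/-! ### The curvature map as a homeomorphism that respects strata. -/

section

variable [Fintype E] [Fintype F] (G : FlagGluing E F) {Φ : E → ℝ}

theorem curvatureMap_mem_LSet (hΦ : ∀ e, Φ e ∈ Set.Ioo 0 (Real.pi / 2)) {k : F → ℝ} (hk : ∀ f, 0 ≤ k f) :
    curvatureMap G Φ k ∈ LSet G Φ :=
  (mem_LSet_iff G hΦ _).2
    ⟨fun f => curvatureMap_nonneg G f (hk f), fun _ h => sum_curvatureMap_lt G hΦ hk h⟩

variable (hΦ : ∀ e, Φ e ∈ Set.Ioo 0 (Real.pi / 2))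

/-- The curvature map as a bijection. -/
def curvatureEquiv : {k : F → ℝ // ∀ f, 0 ≤ k f} ≃ LSet G Φ :=
  Equiv.ofBijective (fun k => ⟨curvatureMap G Φ k.1, curvatureMap_mem_LSet G hΦ k.2⟩) <| by
    refine ⟨fun k k' h => Subtype.ext ?_, fun L => ?_⟩
    · exact curvatureMap_injOn G hΦ k.2 k'.2 (congrArg Subtype.val h)
    · obtain ⟨h1, h2⟩ := (mem_LSet_iff G hΦ L.1).1 L.2
      obtain ⟨k, hk, h⟩ := exists_curvatureMap_eq G hΦ h1 h2
      exact ⟨⟨k, hk⟩, Subtype.ext h⟩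

theorem continuous_curvatureEquiv : Continuous (curvatureEquiv G hΦ) :=
  ((continuous_curvatureMap G hΦ).comp continuous_subtype_val).subtype_mk _

theorem continuous_curvatureEquiv_symm : Continuous (curvatureEquiv G hΦ).symm := by
  rw [continuous_iff_ultrafilter]
  intro L U hU
  obtain ⟨-, hL⟩ := (mem_LSet_iff G hΦ L.1).1 L.2
  obtain ⟨M, ε, hε, hM⟩ := exists_bound_of_curvatureMap_le G hΦ hL
  have hval : ∀ L', curvatureMap G Φ ((curvatureEquiv G hΦ).symm L').1 = L'.1 := fun L' =>
    congrArg Subtype.val ((curvatureEquiv G hΦ).apply_symm_apply L')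
  -- Near `L` the slack `ε` puts all preimages into one compact box. They converge there along the
  -- ultrafilter, and continuity of the forward map identifies the limit as the preimage of `L`.
  have hcomp : IsCompact {k : {k : F → ℝ // ∀ f, 0 ≤ k f} | ∀ f, k.1 f ≤ M} := by
    rw [Subtype.isCompact_iff]
    convert isCompact_Icc (a := (0 : F → ℝ)) (b := fun _ => M) using 1
    ext k
    simp only [Set.mem_image, Set.mem_ofPred_eq, Subtype.exists, exists_and_left, exists_prop,
      Set.mem_Icc, Pi.le_def, Pi.zero_apply]
    exact ⟨by rintro ⟨k, h, h', rfl⟩; exact ⟨h', h⟩, fun h => ⟨k, h.2, h.1, rfl⟩⟩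
  have hev : ∀ᶠ L' in (U : Filter (LSet G Φ)), ∀ f, L'.1 f < L.1 f + ε := by
    refine Filter.eventually_all.2 fun f => hU ?_
    have : Filter.Tendsto (fun L' : LSet G Φ => L'.1 f) (nhds L) (nhds (L.1 f)) :=
      ((continuous_apply f).comp continuous_subtype_val).tendsto L
    exact this.eventually_lt_const (by linarith)
  have hmem : {k : {k : F → ℝ // ∀ f, 0 ≤ k f} | ∀ f, k.1 f ≤ M} ∈
      U.map (curvatureEquiv G hΦ).symm := by
    refine hev.mono fun L' h => hM _ ((curvatureEquiv G hΦ).symm L').2 fun f => ?_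
    rw [hval]
    exact (h f).le
  obtain ⟨k, -, hk⟩ := hcomp.ultrafilter_le_nhds (U.map (curvatureEquiv G hΦ).symm)
    (Filter.le_principal_iff.2 hmem)
  have hk : Filter.Tendsto (curvatureEquiv G hΦ).symm U (nhds k) := hk
  have h1 := ((continuous_curvatureEquiv G hΦ).tendsto k).comp hk
  have h2 : (curvatureEquiv G hΦ) ∘ (curvatureEquiv G hΦ).symm = id := by ext; simp
  rw [h2] at h1
  have h3 : curvatureEquiv G hΦ k = L := tendsto_nhds_unique h1 hU
  rwa [← h3, Equiv.symm_apply_apply]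

/-- The curvature map as a homeomorphism. -/
def curvatureHomeomorph : {k : F → ℝ // ∀ f, 0 ≤ k f} ≃ₜ LSet G Φ where
  toEquiv := curvatureEquiv G hΦ
  continuous_toFun := continuous_curvatureEquiv G hΦ
  continuous_invFun := continuous_curvatureEquiv_symm G hΦ

theorem coe_curvatureHomeomorph (k : {k : F → ℝ // ∀ f, 0 ≤ k f}) :
    (curvatureHomeomorph G hΦ k).1 = curvatureMap G Φ k.1 := rfl

end

theorem mem_orthantStratum_iff [Fintype E] (G : FlagGluing E F) {Φ : E → ℝ}
    (hΦ : ∀ e, Φ e ∈ Set.Ioo 0 (Real.pi / 2)) {k : F → ℝ} (hk : ∀ f, 0 ≤ k f) (I : Finset F) :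
    k ∈ orthantStratum I ↔ curvatureMap G Φ k ∈ LStratum G Φ I := by
  have hlt : curvatureMap G Φ k ∈ {L : F → ℝ | ∀ F' : Finset F, F'.Nonempty →
      ∑ f ∈ F', L f < 2 * ∑ e ∈ G.edgesOf F', Φ e} := fun _ h => sum_curvatureMap_lt G hΦ hk h
  rw [LStratum_eq G hΦ, Set.mem_inter_iff, and_iff_left hlt]
  have hz : ∀ f, k f = 0 ↔ curvatureMap G Φ k f = 0 := fun f => by
    rw [← not_iff_not, ← ne_eq, ← ne_eq, ← (hk f).lt_iff_ne',
      ← (curvatureMap_nonneg G f (hk f)).lt_iff_ne', curvatureMap_pos_iff G (hk f)]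
  unfold orthantStratum
  simp only [Set.mem_ofPred_eq, curvatureMap_pos_iff G (hk _), hz]

theorem mem_orthantBoundary_iff [Fintype E] [Fintype F] (G : FlagGluing E F) {Φ : E → ℝ}
    (hΦ : ∀ e, Φ e ∈ Set.Ioo 0 (Real.pi / 2)) {k : F → ℝ} (hk : ∀ f, 0 ≤ k f) :
    k ∈ orthantBoundary ↔ curvatureMap G Φ k ∈ LBoundary G Φ := by
  have h0 : ({0} : Set (F → ℝ)) = orthantStratum ∅ := by
    ext k
    simp [orthantStratum, funext_iff]
  unfold orthantBoundary LBoundary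
  conv_rhs => rw [← LStratum_empty G Φ]
  rw [h0]
  simp only [Set.mem_union, Set.mem_iUnion, mem_orthantStratum_iff G hΦ hk]

theorem pos_iff_curvatureMap_mem_L₁ [Fintype E] [Fintype F] (G : FlagGluing E F) {Φ : E → ℝ}
    (hΦ : ∀ e, Φ e ∈ Set.Ioo 0 (Real.pi / 2)) {k : F → ℝ} (hk : ∀ f, 0 ≤ k f) :
    (∀ f, 0 < k f) ↔ curvatureMap G Φ k ∈ L₁ G Φ := by
  rw [L₁_eq_LStratum, ← mem_orthantStratum_iff G hΦ hk]
  simp [orthantStratum]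

end

/-! ### The length of a circular arc -/

open MeasureTheory MeasureTheory.Measure in
/-- A lower bound for the length of short arcs of a curve without double points extends to long arcs. -/
theorem le_hausdorffMeasure_image_Ioc {X : Type*} [MetricSpace X] [MeasurableSpace X] [BorelSpace X]
    {γ : ℝ → X} (hγ : Continuous γ) {c δ : ℝ} (hc : 0 ≤ c) (hδ : 0 < δ)
    (h : ∀ a b, a ≤ b → b - a ≤ δ →
      ENNReal.ofReal (c * (b - a)) ≤ hausdorffMeasure (1 : ℝ) (γ '' Set.Ioc a b))
    {p q : ℝ} (hpq : p ≤ q) (hinj : Set.InjOn γ (Set.Ioc p q)) :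
    ENNReal.ofReal (c * (q - p)) ≤ hausdorffMeasure (1 : ℝ) (γ '' Set.Ioc p q) := by
  -- Induction by halving. Half-open intervals split into disjoint halves, and injectivity makes
  -- their images disjoint and measurable, so the measure is additive.
  have key : ∀ (n : ℕ) (p q : ℝ), p ≤ q → q - p ≤ 2 ^ n * δ → Set.InjOn γ (Set.Ioc p q) →
      ENNReal.ofReal (c * (q - p)) ≤ hausdorffMeasure (1 : ℝ) (γ '' Set.Ioc p q) := by
    intro n
    induction n with
    | zero => exact fun p q hpq hn _ => h p q hpq (by simpa using hn)
    | succ n ih =>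
      intro p q hpq hn hinj
      set m := (p + q) / 2 with hm
      have hpm : p ≤ m := by linarith
      have hmq : m ≤ q := by linarith
      rw [pow_succ] at hn
      have s1 : Set.Ioc p m ⊆ Set.Ioc p q := Set.Ioc_subset_Ioc_right hmq
      have s2 : Set.Ioc m q ⊆ Set.Ioc p q := Set.Ioc_subset_Ioc_left hpm
      have i1 := ih p m hpm (by linarith) (hinj.mono s1)
      have i2 := ih m q hmq (by linarith) (hinj.mono s2)
      have hdisj : Disjoint (γ '' Set.Ioc p m) (γ '' Set.Ioc m q) :=
        (Set.Ioc_disjoint_Ioc_of_le le_rfl).image hinj s1 s2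
      rw [← Set.Ioc_union_Ioc_eq_Ioc hpm hmq, Set.image_union, measure_union hdisj
        (measurableSet_Ioc.image_of_continuousOn_injOn hγ.continuousOn (hinj.mono s2))]
      refine le_trans (le_of_eq ?_) (add_le_add i1 i2)
      rw [← ENNReal.ofReal_add (mul_nonneg hc (by linarith)) (mul_nonneg hc (by linarith))]
      congr 1
      ring
  obtain ⟨n, hn⟩ := pow_unbounded_of_one_lt ((q - p) / δ) one_lt_two
  exact key n p q hpq ((div_le_iff₀ hδ).1 hn.le) hinj

/-! ### Circular arcs parametrized by the central angle. -/

section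

variable {V : Type*} [NormedAddCommGroup V] [InnerProductSpace ℝ V]

/-- The parametrization by the central angle of a circle in the plane through `m` spanned by `u`, `w`. -/
def circleCurve (m u w : V) (ρ t : ℝ) : V := m + (ρ * Real.cos t) • u + (ρ * Real.sin t) • w

theorem dist_circleCurve {m u w : V} (hu : ‖u‖ = 1) (hw : ‖w‖ = 1) (huw : ⟪u, w⟫ = 0) {ρ : ℝ}
    (hρ : 0 ≤ ρ) (s t : ℝ) :
    dist (circleCurve m u w ρ s) (circleCurve m u w ρ t) = 2 * ρ * |Real.sin ((s - t) / 2)| := by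
  have e : circleCurve m u w ρ s - circleCurve m u w ρ t =
      (ρ * (Real.cos s - Real.cos t)) • u + (ρ * (Real.sin s - Real.sin t)) • w := by
    unfold circleCurve; module
  rw [dist_eq_norm, e, ← Real.sqrt_sq (norm_nonneg _), norm_add_sq_real, inner_smul_left,
    inner_smul_right, huw, norm_smul, norm_smul, hu, hw]
  rw [← Real.sqrt_sq (show 0 ≤ 2 * ρ * |Real.sin ((s - t) / 2)| by positivity)]
  congr 1
  simp only [mul_one, mul_zero, add_zero, Real.norm_eq_abs, mul_pow, sq_abs]
  rw [Real.cos_sub_cos, Real.sin_sub_sin]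
  linear_combination (4 * ρ ^ 2 * Real.sin ((s - t) / 2) ^ 2) *
    Real.sin_sq_add_cos_sq ((s + t) / 2)

theorem dist_circleCurve_le {m u w : V} (hu : ‖u‖ = 1) (hw : ‖w‖ = 1) (huw : ⟪u, w⟫ = 0) {ρ : ℝ}
    (hρ : 0 ≤ ρ) (s t : ℝ) :
    dist (circleCurve m u w ρ s) (circleCurve m u w ρ t) ≤ ρ * |s - t| := by
  rw [dist_circleCurve hu hw huw hρ]
  have h : |Real.sin ((s - t) / 2)| ≤ |(s - t) / 2| := Real.abs_sin_le_abs
  rw [abs_div, abs_two] at h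
  nlinarith

/-- From `sin u > u - u ^ 3 / 6`: for `|s - t| ≤ δ ≤ 1` the cubic term is absorbed into the factor
`1 - δ`. -/
theorem le_dist_circleCurve {m u w : V} (hu : ‖u‖ = 1) (hw : ‖w‖ = 1) (huw : ⟪u, w⟫ = 0) {ρ : ℝ}
    (hρ : 0 ≤ ρ) {δ : ℝ} (hδ : δ ≤ 1) {s t : ℝ} (hst : |s - t| ≤ δ) :
    ρ * (1 - δ) * |s - t| ≤ dist (circleCurve m u w ρ s) (circleCurve m u w ρ t) := by
  rw [dist_circleCurve hu hw huw hρ]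
  rcases (abs_nonneg (s - t)).eq_or_lt with h0 | h0
  · rw [← h0, mul_zero]; positivity
  have h1 := Real.sin_gt_sub_cube (x := |s - t| / 2) (by linarith)
  have h2 : Real.sin (|s - t| / 2) ≤ |Real.sin ((s - t) / 2)| := by
    rcases abs_cases (s - t) with ⟨h, -⟩ | ⟨h, -⟩
    · rw [h]; exact le_abs_self _
    · rw [h, neg_div, Real.sin_neg]; exact neg_le_abs _
  have h3 : (|s - t| / 2) ^ 3 / 6 ≤ δ * (|s - t| / 2) := by
    have h4 : |s - t| ^ 2 ≤ δ := by nlinarith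
    have h5 : |s - t| ^ 2 * |s - t| ≤ δ * |s - t| := mul_le_mul_of_nonneg_right h4 h0.le
    have h6 : 0 ≤ |s - t| ^ 2 * |s - t| := by positivity
    nlinarith
  have h7 : (1 - δ) * (|s - t| / 2) ≤ |Real.sin ((s - t) / 2)| := by linarith
  nlinarith [mul_le_mul_of_nonneg_left h7 hρ]

theorem continuous_circleCurve (m u w : V) (ρ : ℝ) : Continuous (circleCurve m u w ρ) := by
  unfold circleCurve; fun_prop

theorem injOn_circleCurve {m u w : V} (hu : ‖u‖ = 1) (hw : ‖w‖ = 1) (huw : ⟪u, w⟫ = 0) {ρ : ℝ}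
    (hρ : 0 < ρ) {θ : ℝ} (hθ : θ ≤ Real.pi) :
    Set.InjOn (circleCurve m u w ρ) (Set.Ioc (-θ) θ) := by
  intro s hs t ht h
  have h1 := dist_circleCurve (m := m) hu hw huw hρ.le s t
  rw [h, dist_self, eq_comm, mul_eq_zero, abs_eq_zero,
    Real.sin_eq_zero_iff_of_lt_of_lt (by linarith [hs.1, ht.2]) (by linarith [ht.1, hs.2])] at h1
  rcases h1 with h1 | h1
  · exact absurd h1 (by positivity)
  · linarith

open MeasureTheory MeasureTheory.Measure in
-- The upper bound is the Lipschitz constant `ρ`. For the lower bound, pieces of length at most `δ`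
-- are antilipschitz with constant `(ρ * (1 - δ))⁻¹`; gluing them and letting `δ` tend to `0` gives
-- the same value.
theorem hausdorffMeasure_circleCurve [MeasurableSpace V] [BorelSpace V] {m u w : V} (hu : ‖u‖ = 1)
    (hw : ‖w‖ = 1) (huw : ⟪u, w⟫ = 0) {ρ : ℝ} (hρ : 0 < ρ) {θ : ℝ} (h0 : 0 ≤ θ)
    (hθ : θ ≤ Real.pi) :
    hausdorffMeasure (1 : ℝ) (circleCurve m u w ρ '' Set.Ioo (-θ) θ) =
      ENNReal.ofReal (2 * θ * ρ) := by
  set γ := circleCurve m u w ρ with hγ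
  apply le_antisymm
  · have hlip : LipschitzWith ρ.toNNReal γ := LipschitzWith.of_dist_le_mul fun s t => by
      rw [Real.coe_toNNReal _ hρ.le]
      exact dist_circleCurve_le hu hw huw hρ.le s t
    refine (hlip.hausdorffMeasure_image_le zero_le_one _).trans (le_of_eq ?_)
    rw [hausdorffMeasure_real, Real.volume_Ioo, ENNReal.rpow_one,
      show (ρ.toNNReal : ℝ≥0∞) = ENNReal.ofReal ρ from rfl, ← ENNReal.ofReal_mul hρ.le]
    congr 1
    ring
  -- Subdivision works with half-open intervals; the extra endpoint is a null set.
  · have hIoc : hausdorffMeasure (1 : ℝ) (γ '' Set.Ioc (-θ) θ) ≤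
        hausdorffMeasure (1 : ℝ) (γ '' Set.Ioo (-θ) θ) := by
      have hsub : γ '' Set.Ioc (-θ) θ ⊆ γ '' Set.Ioo (-θ) θ ∪ {γ θ} := by
        rintro _ ⟨t, ht, rfl⟩
        rcases ht.2.eq_or_lt with h | h
        · exact Or.inr (by rw [h]; rfl)
        · exact Or.inl ⟨t, ⟨ht.1, h⟩, rfl⟩
      have : NullSingletonClass (hausdorffMeasure (1 : ℝ) : Measure V) := nullSingletonClass_hausdorff V one_pos
      refine (measure_mono hsub).trans ((measure_union_le _ _).trans ?_)
      rw [measure_singleton, add_zero]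
    refine le_trans ?_ hIoc
    have hδ : ∀ δ : ℝ, 0 < δ → δ < 1 → ENNReal.ofReal (ρ * (1 - δ) * (θ - -θ)) ≤
        hausdorffMeasure (1 : ℝ) (γ '' Set.Ioc (-θ) θ) := by
      intro δ hδ0 hδ1
      have hpos : 0 < ρ * (1 - δ) := mul_pos hρ (by linarith)
      refine le_hausdorffMeasure_image_Ioc (continuous_circleCurve m u w ρ)
        hpos.le hδ0 (fun a b hab hd => ?_) (by linarith) (injOn_circleCurve hu hw huw hρ hθ)
      have hanti : AntilipschitzWith (ρ * (1 - δ)).toNNReal⁻¹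
          (fun t : Set.Ioc a b => γ t) := by
        refine AntilipschitzWith.of_le_mul_dist fun s t => ?_
        have hst : |(s : ℝ) - t| ≤ δ := by
          rw [abs_le]
          constructor <;> linarith [s.2.1, s.2.2, t.2.1, t.2.2]
        have := le_dist_circleCurve (m := m) hu hw huw hρ.le hδ1.le hst
        rw [NNReal.coe_inv, Real.coe_toNNReal _ hpos.le, inv_mul_eq_div, le_div_iff₀ hpos, mul_comm]
        exact this
      have h1 := hanti.le_hausdorffMeasure_image (d := 1) zero_le_one Set.univ
      have h2 : hausdorffMeasure (1 : ℝ) (Set.univ : Set (Set.Ioc a b)) =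
          ENNReal.ofReal (b - a) := by
        rw [← (isometry_subtype_coe (s := Set.Ioc a b)).hausdorffMeasure_image
          (Or.inl zero_le_one), Set.image_univ, Subtype.range_coe, hausdorffMeasure_real,
          Real.volume_Ioc]
      have h3 : (fun t : Set.Ioc a b => γ t) '' Set.univ = γ '' Set.Ioc a b := by
        ext x; simp
      rw [h2, h3, ENNReal.rpow_one, ENNReal.coe_inv (by simpa using hpos), ← ENNReal.div_eq_inv_mul,
        ENNReal.le_div_iff_mul_le (Or.inl (by simpa using hpos)) (Or.inl ENNReal.coe_ne_top)] at h1
      rwa [ENNReal.ofReal_mul hpos.le, mul_comm]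
    have hlim : Filter.Tendsto (fun δ : ℝ => ENNReal.ofReal (ρ * (1 - δ) * (θ - -θ)))
        (nhdsWithin 0 (Set.Ioi 0)) (nhds (ENNReal.ofReal (ρ * (1 - 0) * (θ - -θ)))) :=
      (ENNReal.continuous_ofReal.comp (by fun_prop :
        Continuous fun δ : ℝ => ρ * (1 - δ) * (θ - -θ))).continuousAt.mono_left nhdsWithin_le_nhds
    have hle := le_of_tendsto hlim (by
      filter_upwards [self_mem_nhdsWithin, Ioo_mem_nhdsGT one_pos] with δ h1 h2
      exact hδ δ h1 h2.2)
    convert hle using 2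
    ring

end

/-! ### Lenses in coordinates -/

/-- The vector with coordinates `x`, `y`, `z` in an orthonormal frame. -/
def frameVec (b : OrthonormalBasis (Fin 3) ℝ E3) (x y z : ℝ) : E3 := x • b 0 + y • b 1 + z • b 2

theorem inner_frameVec (b : OrthonormalBasis (Fin 3) ℝ E3) (x y z x' y' z' : ℝ) :
    ⟪frameVec b x y z, frameVec b x' y' z'⟫ = x * x' + y * y' + z * z' := by
  have h := fun i j => b.inner_eq_ite i j
  simp only [frameVec, inner_add_left, inner_add_right, inner_smul_left, inner_smul_right, h]
  simp
  ring

theorem norm_frameVec_sq (b : OrthonormalBasis (Fin 3) ℝ E3) (x y z : ℝ) :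
    ‖frameVec b x y z‖ ^ 2 = x ^ 2 + y ^ 2 + z ^ 2 := by
  rw [← real_inner_self_eq_norm_sq, inner_frameVec]
  ring

theorem norm_frameVec_eq_one_iff (b : OrthonormalBasis (Fin 3) ℝ E3) (x y z : ℝ) :
    ‖frameVec b x y z‖ = 1 ↔ x ^ 2 + y ^ 2 + z ^ 2 = 1 := by
  rw [← norm_frameVec_sq b, pow_eq_one_iff_of_nonneg (norm_nonneg _) two_ne_zero]

theorem eq_frameVec (b : OrthonormalBasis (Fin 3) ℝ E3) (v : E3) :
    v = frameVec b ⟪b 0, v⟫ ⟪b 1, v⟫ ⟪b 2, v⟫ := by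
  rw [frameVec, ← Fin.sum_univ_three fun i => ⟪b i, v⟫ • b i, b.sum_repr']

theorem frameVec_inj (b : OrthonormalBasis (Fin 3) ℝ E3) {x y z x' y' z' : ℝ}
    (h : frameVec b x y z = frameVec b x' y' z') : z = z' := by
  have h1 := congrArg (fun v => ⟪frameVec b 0 0 1, v⟫) h
  simpa [inner_frameVec] using h1

theorem angle_eq_iff {c x : E3} (hc : ‖c‖ = 1) (hx : ‖x‖ = 1) {r : ℝ} (h0 : 0 ≤ r)
    (h1 : r ≤ Real.pi) : InnerProductGeometry.angle c x = r ↔ ⟪c, x⟫ = Real.cos r := by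
  rw [← Real.injOn_cos.eq_iff ⟨InnerProductGeometry.angle_nonneg c x,
    InnerProductGeometry.angle_le_pi c x⟩ ⟨h0, h1⟩, InnerProductGeometry.cos_angle, hc, hx]
  simp

theorem angle_lt_iff {c x : E3} (hc : ‖c‖ = 1) (hx : ‖x‖ = 1) {r : ℝ} (h0 : 0 ≤ r)
    (h1 : r ≤ Real.pi) : InnerProductGeometry.angle c x < r ↔ Real.cos r < ⟪c, x⟫ := by
  rw [← Real.strictAntiOn_cos.lt_iff_gt ⟨h0, h1⟩ ⟨InnerProductGeometry.angle_nonneg c x,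
    InnerProductGeometry.angle_le_pi c x⟩, InnerProductGeometry.cos_angle, hc, hx]
  simp

/-- Two circles with centers `c`, `c'` and radii `r`, `r'` that meet in the points `p`, `q` such that the
bigon in which the disks intersect has interior angle `φ` at `p`. -/
structure IsLens (c c' p q : E3) (r r' φ : ℝ) : Prop where
  norm_left : ‖c‖ = 1
  norm_right : ‖c'‖ = 1
  left_mem : p ∈ sphCircle c r
  right_mem : p ∈ sphCircle c' r'
  left_mem' : q ∈ sphCircle c r
  right_mem' : q ∈ sphCircle c' r'
  ne : p ≠ q
  angle_eq : Real.pi - sphAngle p c c' = φ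

theorem IsLens.symm {c c' p q : E3} {r r' φ : ℝ} (h : IsLens c c' p q r r' φ) :
    IsLens c' c p q r' r φ where
  norm_left := h.norm_right
  norm_right := h.norm_left
  left_mem := h.right_mem
  right_mem := h.left_mem
  left_mem' := h.right_mem'
  right_mem' := h.left_mem'
  ne := h.ne
  angle_eq := by rw [← h.angle_eq, sphAngle, sphAngle, InnerProductGeometry.angle_comm]

/-- Cosine of the distance of the centers of the circles of a lens. -/
def lensCos (r r' φ : ℝ) : ℝ :=
  Real.cos r * Real.cos r' - Real.sin r * Real.sin r' * Real.cos φ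

/-- Sine of the distance of the centers of the circles of a lens. -/
def lensSin (r r' φ : ℝ) : ℝ := √(1 - lensCos r r' φ ^ 2)

/-- The angle at the first center of a lens between the arcs to a corner and to the other center. -/
def lensAngle (r r' φ : ℝ) : ℝ :=
  Real.pi / 2 - Real.arctan ((Real.sin r * Real.cot r' + Real.cos r * Real.cos φ) / Real.sin φ)

theorem sin_pos_of_mem_Ioc {r : ℝ} (hr : r ∈ Set.Ioc 0 (Real.pi / 2)) : 0 < Real.sin r :=
  Real.sin_pos_of_pos_of_lt_pi hr.1 (by linarith [hr.2, Real.pi_pos])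

/-- With `d` the distance of the centers and `θ` the angle at the first one, the squares are those
of `sin d * cos θ` and `sin d * sin θ`. The second is positive, so the centers are neither equal nor
antipodal. -/
theorem one_sub_lensCos_sq (r r' φ : ℝ) : 1 - lensCos r r' φ ^ 2 =
    (Real.sin r * Real.cos r' + Real.cos r * Real.sin r' * Real.cos φ) ^ 2 +
      (Real.sin r' * Real.sin φ) ^ 2 := by
  unfold lensCos
  rw [mul_pow (Real.sin r'), Real.sin_sq φ]
  have h := Real.sin_sq_add_cos_sq r
  have h' := Real.sin_sq_add_cos_sq r'
  linear_combination (-Real.cos r' ^ 2 - Real.sin r' ^ 2 * Real.cos φ ^ 2) * h - h'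

/-! ### Spherical trigonometry and the normal form of a lens. -/

section

variable {r r' φ : ℝ}

theorem one_sub_lensCos_sq_pos (hr' : r' ∈ Set.Ioc 0 (Real.pi / 2))
    (hφ : φ ∈ Set.Ioo 0 (Real.pi / 2)) : 0 < 1 - lensCos r r' φ ^ 2 := by
  rw [one_sub_lensCos_sq]
  have := mul_pos (sin_pos_of_mem_Ioc hr') (sin_pos_of_mem_Ioo hφ)
  positivity

theorem lensSin_pos (hr' : r' ∈ Set.Ioc 0 (Real.pi / 2))
    (hφ : φ ∈ Set.Ioo 0 (Real.pi / 2)) : 0 < lensSin r r' φ :=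
  Real.sqrt_pos.2 (one_sub_lensCos_sq_pos hr' hφ)

theorem lensSin_sq (hr' : r' ∈ Set.Ioc 0 (Real.pi / 2))
    (hφ : φ ∈ Set.Ioo 0 (Real.pi / 2)) : lensSin r r' φ ^ 2 = 1 - lensCos r r' φ ^ 2 :=
  Real.sq_sqrt (one_sub_lensCos_sq_pos hr' hφ).le

/-- The sine rule: the root is the reciprocal of the sine of `lensAngle`. -/
theorem lensSin_eq (hr' : r' ∈ Set.Ioc 0 (Real.pi / 2)) (hφ : φ ∈ Set.Ioo 0 (Real.pi / 2)) :
    lensSin r r' φ = Real.sin r' * Real.sin φ *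
      √(1 + ((Real.sin r * Real.cot r' + Real.cos r * Real.cos φ) / Real.sin φ) ^ 2) := by
  have h1 := sin_pos_of_mem_Ioc hr'
  have h2 := sin_pos_of_mem_Ioo hφ
  rw [lensSin, Real.sqrt_eq_iff_mul_self_eq (one_sub_lensCos_sq_pos hr' hφ).le (by positivity),
    one_sub_lensCos_sq, mul_mul_mul_comm, Real.mul_self_sqrt (by positivity),
    Real.cot_eq_cos_div_sin]
  field_simp
  ring

theorem lensSin_mul_cos (hr' : r' ∈ Set.Ioc 0 (Real.pi / 2)) (hφ : φ ∈ Set.Ioo 0 (Real.pi / 2)) :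
    lensSin r r' φ * Real.cos (lensAngle r r' φ) =
      Real.sin r * Real.cos r' + Real.cos r * Real.sin r' * Real.cos φ := by
  have h1 := sin_pos_of_mem_Ioc hr'
  have h2 := sin_pos_of_mem_Ioo hφ
  rw [lensSin_eq hr' hφ, lensAngle, Real.cos_pi_div_two_sub, Real.sin_arctan]
  set z := (Real.sin r * Real.cot r' + Real.cos r * Real.cos φ) / Real.sin φ with hz
  have h3 := sqrt_one_add_sq_pos z
  rw [mul_assoc, mul_div_cancel₀ _ h3.ne', hz, Real.cot_eq_cos_div_sin]
  field_simp

theorem lensAngle_pos (r r' φ : ℝ) : 0 < lensAngle r r' φ := by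
  unfold lensAngle
  linarith [Real.arctan_lt_pi_div_two
    ((Real.sin r * Real.cot r' + Real.cos r * Real.cos φ) / Real.sin φ)]

theorem lensAngle_lt_pi (r r' φ : ℝ) : lensAngle r r' φ < Real.pi := by
  unfold lensAngle
  linarith [Real.neg_pi_div_two_lt_arctan
    ((Real.sin r * Real.cot r' + Real.cos r * Real.cos φ) / Real.sin φ)]

/-- The spherical law of cosines at the first center. -/
theorem lensCos_mul_add (hr' : r' ∈ Set.Ioc 0 (Real.pi / 2)) (hφ : φ ∈ Set.Ioo 0 (Real.pi / 2)) :
    lensCos r r' φ * Real.cos r + lensSin r r' φ * (Real.sin r * Real.cos (lensAngle r r' φ)) =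
      Real.cos r' := by
  have h := lensSin_mul_cos (r := r) hr' hφ
  rw [mul_left_comm, h, lensCos]
  linear_combination Real.cos r' * Real.sin_sq_add_cos_sq r

theorem norm_sub_inner_smul {p c : E3} (hp : ‖p‖ = 1) (hc : ‖c‖ = 1) {r : ℝ}
    (hr : r ∈ Set.Ioc 0 (Real.pi / 2)) (h : ⟪p, c⟫ = Real.cos r) :
    ‖c - ⟪p, c⟫ • p‖ = Real.sin r := by
  rw [← sq_eq_sq₀ (norm_nonneg _) (sin_pos_of_mem_Ioc hr).le, norm_sub_sq_real, inner_smul_right,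
    norm_smul, mul_pow, hc, hp, real_inner_comm p c, h, Real.sin_sq, Real.norm_eq_abs, sq_abs]
  ring

theorem inner_sub_inner_smul {p c c' : E3} (hp : ‖p‖ = 1) :
    ⟪c - ⟪p, c⟫ • p, c' - ⟪p, c'⟫ • p⟫ = ⟪c, c'⟫ - ⟪p, c⟫ * ⟪p, c'⟫ := by
  rw [inner_sub_left, inner_sub_right, inner_sub_right, inner_smul_left, inner_smul_left,
    inner_smul_right, inner_smul_right, real_inner_self_eq_norm_sq, hp, real_inner_comm p c]
  simp [mul_comm]

theorem inner_eq_of_mem_sphCircle {c p : E3} (hc : ‖c‖ = 1) (hr : r ∈ Set.Ioc 0 (Real.pi / 2))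
    (h : p ∈ sphCircle c r) : ⟪c, p⟫ = Real.cos r :=
  (angle_eq_iff hc h.1 hr.1.le (by linarith [hr.2, Real.pi_pos])).1 h.2

theorem mem_sphCircle_iff {c p : E3} (hc : ‖c‖ = 1) (hr : r ∈ Set.Ioc 0 (Real.pi / 2)) :
    p ∈ sphCircle c r ↔ ‖p‖ = 1 ∧ ⟪c, p⟫ = Real.cos r :=
  and_congr_right fun hp => angle_eq_iff hc hp hr.1.le (by linarith [hr.2, Real.pi_pos])

/-- The spherical law of cosines at the corner `p`, where the angle between the centers is `π - φ`;
the tangential components there have lengths `sin r` and `sin r'`. -/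
theorem IsLens.inner_centers {c c' p q : E3} (h : IsLens c c' p q r r' φ)
    (hr : r ∈ Set.Ioc 0 (Real.pi / 2)) (hr' : r' ∈ Set.Ioc 0 (Real.pi / 2)) :
    ⟪c, c'⟫ = lensCos r r' φ := by
  have hp : ‖p‖ = 1 := h.left_mem.1
  have h1 : ⟪p, c⟫ = Real.cos r := by
    rw [real_inner_comm]; exact inner_eq_of_mem_sphCircle h.norm_left hr h.left_mem
  have h2 : ⟪p, c'⟫ = Real.cos r' := by
    rw [real_inner_comm]; exact inner_eq_of_mem_sphCircle h.norm_right hr' h.right_mem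
  have h3 := InnerProductGeometry.cos_angle_mul_norm_mul_norm (c - ⟪p, c⟫ • p) (c' - ⟪p, c'⟫ • p)
  rw [norm_sub_inner_smul hp h.norm_left hr h1, norm_sub_inner_smul hp h.norm_right hr' h2,
    inner_sub_inner_smul hp] at h3
  have h4 : InnerProductGeometry.angle (c - ⟪p, c⟫ • p) (c' - ⟪p, c'⟫ • p) = Real.pi - φ := by
    rw [← h.angle_eq, sphAngle]; ring
  rw [h4, Real.cos_pi_sub, h1, h2] at h3
  rw [lensCos]
  linarith

/-- The corners of a lens in the frame of its first center. -/
def lensCorner (b : OrthonormalBasis (Fin 3) ℝ E3) (r r' φ σ : ℝ) : E3 :=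
  frameVec b (Real.cos r) (Real.sin r * Real.cos (lensAngle r r' φ))
    (σ * (Real.sin r * Real.sin (lensAngle r r' φ)))

/-- The second center of a lens in the frame of its first center. -/
def lensCenter (b : OrthonormalBasis (Fin 3) ℝ E3) (r r' φ : ℝ) : E3 :=
  frameVec b (lensCos r r' φ) (lensSin r r' φ) 0

theorem exists_frame {c c' : E3} (hc : ‖c‖ = 1) (hc' : ‖c'‖ = 1)
    (hr' : r' ∈ Set.Ioc 0 (Real.pi / 2)) (hφ : φ ∈ Set.Ioo 0 (Real.pi / 2))
    (h : ⟪c, c'⟫ = lensCos r r' φ) :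
    ∃ b : OrthonormalBasis (Fin 3) ℝ E3, c = frameVec b 1 0 0 ∧ c' = lensCenter b r r' φ := by
  have hpos := lensSin_pos (r := r) hr' hφ
  set u : E3 := (lensSin r r' φ)⁻¹ • (c' - lensCos r r' φ • c) with hu
  have h1 : ‖c' - lensCos r r' φ • c‖ = lensSin r r' φ := by
    rw [← sq_eq_sq₀ (norm_nonneg _) hpos.le, lensSin_sq hr' hφ, norm_sub_sq_real, inner_smul_right,
      norm_smul, mul_pow, hc, hc', real_inner_comm, h, Real.norm_eq_abs, sq_abs]
    ring
  have h2 : ‖u‖ = 1 := by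
    rw [hu, norm_smul, h1, norm_inv, Real.norm_eq_abs, abs_of_pos hpos, inv_mul_cancel₀ hpos.ne']
  have h3 : ⟪c, u⟫ = 0 := by
    rw [hu, inner_smul_right, inner_sub_right, inner_smul_right, h, real_inner_self_eq_norm_sq, hc]
    ring
  -- Only the entries `0` and `1` are prescribed; the third entry `0` is a dummy that the extension
  -- to a basis replaces.
  have hv : Orthonormal ℝ (Set.domRestrict ({0, 1} : Set (Fin 3)) ![c, u, 0]) := by
    constructor
    · rintro ⟨i, rfl | rfl⟩
      · exact hc
      · exact h2
    · rintro ⟨i, rfl | rfl⟩ ⟨j, rfl | rfl⟩ hij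
      · exact absurd rfl hij
      · exact h3
      · exact (real_inner_comm _ _).trans h3
      · exact absurd rfl hij
  obtain ⟨b, hb⟩ := hv.exists_orthonormalBasis_extension_of_card_eq (by simp)
  have hb0 : b 0 = c := hb 0 (by simp)
  have hb1 : b 1 = u := hb 1 (by simp)
  refine ⟨b, by simp [frameVec, hb0], ?_⟩
  rw [lensCenter, frameVec, hb0, hb1, hu, smul_smul, mul_inv_cancel₀ hpos.ne']
  module

/-- Reflection in the plane of the two centers; it exchanges the corners of a lens. -/
theorem exists_flip (b : OrthonormalBasis (Fin 3) ℝ E3) :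
    ∃ b' : OrthonormalBasis (Fin 3) ℝ E3, ∀ x y z, frameVec b' x y z = frameVec b x y (-z) := by
  have hm : ∀ i : Fin 3, i ≠ 2 → (ℝ ∙ b 2)ᗮ.reflection (b i) = b i := fun i hi =>
    Submodule.reflection_mem_subspace_eq_self
      ((Submodule.mem_orthogonal_singleton_iff_inner_right).2 (b.orthonormal.2 hi.symm))
  refine ⟨b.map (ℝ ∙ b 2)ᗮ.reflection, fun x y z => ?_⟩
  simp only [frameVec, OrthonormalBasis.map_apply, hm 0 (by decide), hm 1 (by decide),
    Submodule.reflection_orthogonalComplement_singleton_eq_neg]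
  module

/-- The two inner products fix the first two coordinates, and the unit norm fixes the third up to
sign. -/
theorem eq_lensCorner_of_mem (b : OrthonormalBasis (Fin 3) ℝ E3)
    (hr' : r' ∈ Set.Ioc 0 (Real.pi / 2)) (hφ : φ ∈ Set.Ioo 0 (Real.pi / 2)) {p : E3}
    (hp : ‖p‖ = 1) (h : ⟪frameVec b 1 0 0, p⟫ = Real.cos r)
    (h' : ⟪lensCenter b r r' φ, p⟫ = Real.cos r') :
    p = lensCorner b r r' φ 1 ∨ p = lensCorner b r r' φ (-1) := by
  obtain ⟨x, y, z, rfl⟩ : ∃ x y z, p = frameVec b x y z := ⟨_, _, _, eq_frameVec b p⟩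
  rw [inner_frameVec] at h
  rw [lensCenter, inner_frameVec] at h'
  rw [norm_frameVec_eq_one_iff] at hp
  have hx : x = Real.cos r := by linarith
  have hy : y = Real.sin r * Real.cos (lensAngle r r' φ) := by
    have := lensCos_mul_add (r := r) hr' hφ
    rw [hx] at h'
    exact mul_left_cancel₀ (lensSin_pos (r := r) hr' hφ).ne' (by linarith)
  have hz : z ^ 2 = (Real.sin r * Real.sin (lensAngle r r' φ)) ^ 2 := by
    rw [hx, hy] at hp
    have e1 := Real.sin_sq_add_cos_sq r
    have e2 := Real.sin_sq_add_cos_sq (lensAngle r r' φ)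
    linear_combination hp - e1 - Real.sin r ^ 2 * e2
  rcases sq_eq_sq_iff_eq_or_eq_neg.1 hz with h1 | h1
  · left; rw [lensCorner, hx, hy, h1, one_mul]
  · right; rw [lensCorner, hx, hy, h1, neg_one_mul]

/-- The normal form of a lens. -/
theorem IsLens.exists_frame {c c' p q : E3} (h : IsLens c c' p q r r' φ)
    (hr : r ∈ Set.Ioc 0 (Real.pi / 2)) (hr' : r' ∈ Set.Ioc 0 (Real.pi / 2))
    (hφ : φ ∈ Set.Ioo 0 (Real.pi / 2)) :
    ∃ b : OrthonormalBasis (Fin 3) ℝ E3, c = frameVec b 1 0 0 ∧ c' = lensCenter b r r' φ ∧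
      p = lensCorner b r r' φ 1 ∧ q = lensCorner b r r' φ (-1) := by
  obtain ⟨b, hc, hc'⟩ := CirclePattern.exists_frame h.norm_left h.norm_right hr' hφ
    (h.inner_centers hr hr')
  have hp := eq_lensCorner_of_mem b hr' hφ h.left_mem.1
    (hc ▸ inner_eq_of_mem_sphCircle h.norm_left hr h.left_mem)
    (hc' ▸ inner_eq_of_mem_sphCircle h.norm_right hr' h.right_mem)
  have hq := eq_lensCorner_of_mem b hr' hφ h.left_mem'.1
    (hc ▸ inner_eq_of_mem_sphCircle h.norm_left hr h.left_mem')
    (hc' ▸ inner_eq_of_mem_sphCircle h.norm_right hr' h.right_mem')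
  rcases hp with hp | hp <;> rcases hq with hq | hq
  · exact absurd (hp.trans hq.symm) h.ne
  · exact ⟨b, hc, hc', hp, hq⟩
  · obtain ⟨b', hb'⟩ := exists_flip b
    refine ⟨b', ?_, ?_, ?_, ?_⟩
    · rw [hc, hb', neg_zero]
    · rw [hc', lensCenter, lensCenter, hb', neg_zero]
    · rw [hp, lensCorner, lensCorner, hb', neg_mul]
    · rw [hq, lensCorner, lensCorner, hb', neg_mul, neg_neg]
  · exact absurd (hp.trans hq.symm) h.ne

/-- Every frame carries a lens. -/
theorem isLens_frame (b : OrthonormalBasis (Fin 3) ℝ E3) (hr : r ∈ Set.Ioc 0 (Real.pi / 2))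
    (hr' : r' ∈ Set.Ioc 0 (Real.pi / 2)) (hφ : φ ∈ Set.Ioo 0 (Real.pi / 2)) {σ : ℝ}
    (hσ : σ ^ 2 = 1) :
    IsLens (frameVec b 1 0 0) (lensCenter b r r' φ) (lensCorner b r r' φ σ)
      (lensCorner b r r' φ (-σ)) r r' φ := by
  have hn : ‖frameVec b 1 0 0‖ = 1 := by rw [norm_frameVec_eq_one_iff]; norm_num
  have hn' : ‖lensCenter b r r' φ‖ = 1 := by
    rw [lensCenter, norm_frameVec_eq_one_iff, lensSin_sq hr' hφ]; ring
  have hp : ∀ τ : ℝ, τ ^ 2 = 1 → ‖lensCorner b r r' φ τ‖ = 1 := fun τ hτ => by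
    rw [lensCorner, norm_frameVec_eq_one_iff, mul_pow τ, hτ]
    linear_combination Real.sin_sq_add_cos_sq r +
      Real.sin r ^ 2 * Real.sin_sq_add_cos_sq (lensAngle r r' φ)
  have h1 : ∀ τ : ℝ, ⟪frameVec b 1 0 0, lensCorner b r r' φ τ⟫ = Real.cos r := fun τ => by
    rw [lensCorner, inner_frameVec]; ring
  have h2 : ∀ τ : ℝ, ⟪lensCenter b r r' φ, lensCorner b r r' φ τ⟫ = Real.cos r' := fun τ => by
    rw [lensCorner, lensCenter, inner_frameVec, ← lensCos_mul_add (r := r) hr' hφ]; ring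
  have hσ' : (-σ) ^ 2 = 1 := by rw [neg_sq, hσ]
  have hs := sin_pos_of_mem_Ioc hr
  have hs' := sin_pos_of_mem_Ioc hr'
  refine ⟨hn, hn', (mem_sphCircle_iff hn hr).2 ⟨hp σ hσ, h1 σ⟩,
    (mem_sphCircle_iff hn' hr').2 ⟨hp σ hσ, h2 σ⟩, (mem_sphCircle_iff hn hr).2 ⟨hp _ hσ', h1 _⟩,
    (mem_sphCircle_iff hn' hr').2 ⟨hp _ hσ', h2 _⟩, fun h => ?_, ?_⟩
  · have h3 := frameVec_inj b h
    have h4 : 0 < Real.sin (lensAngle r r' φ) :=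
      Real.sin_pos_of_pos_of_lt_pi (lensAngle_pos r r' φ) (lensAngle_lt_pi r r' φ)
    have h5 := mul_right_cancel₀ (mul_pos hs h4).ne' h3
    have h6 : σ = 0 := by linarith
    rw [h6] at hσ
    norm_num at hσ
  · have h1' := (real_inner_comm _ _).trans (h1 σ)
    have h2' := (real_inner_comm _ _).trans (h2 σ)
    have h3 : ⟪frameVec b 1 0 0, lensCenter b r r' φ⟫ = lensCos r r' φ := by
      rw [lensCenter, inner_frameVec]; ring
    have h4 : sphAngle (lensCorner b r r' φ σ) (frameVec b 1 0 0) (lensCenter b r r' φ) =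
        Real.pi - φ := by
      rw [sphAngle, InnerProductGeometry.angle, inner_sub_inner_smul (hp σ hσ),
        norm_sub_inner_smul (hp σ hσ) hn hr h1', norm_sub_inner_smul (hp σ hσ) hn' hr' h2', h1',
        h2', h3]
      have h5 : (lensCos r r' φ - Real.cos r * Real.cos r') / (Real.sin r * Real.sin r') =
          -Real.cos φ := by
        rw [lensCos]
        field_simp
        ring
      rw [h5, Real.arccos_neg, Real.arccos_cos hφ.1.le (by linarith [hφ.1, hφ.2])]
    rw [h4]
    ring

end

theorem exists_cos_sin_eq {x y : ℝ} (h : x ^ 2 + y ^ 2 = 1) :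
    ∃ t ∈ Set.Ioc (-Real.pi) Real.pi, x = Real.cos t ∧ y = Real.sin t := by
  have hn : ‖(⟨x, y⟩ : ℂ)‖ = 1 := by
    rw [← sq_eq_sq₀ (norm_nonneg _) zero_le_one, Complex.sq_norm, Complex.normSq_mk]
    linarith
  have h0 : (⟨x, y⟩ : ℂ) ≠ 0 := by
    intro h1; rw [h1, norm_zero] at hn; exact zero_ne_one hn
  refine ⟨Complex.arg ⟨x, y⟩, Complex.arg_mem_Ioc _, ?_, ?_⟩
  · rw [Complex.cos_arg h0, hn, div_one]
  · rw [Complex.sin_arg, hn, div_one]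

section

/-! ### Side lengths, rigidity and existence -/

/-- On the first circle, parametrized by the central angle `t` from the direction of the other
center, lying in the second disk means `cos θ < cos t` with `θ = lensAngle r r' φ`, so the side is
the arc `|t| < θ`. -/
theorem IsLens.hausdorffMeasure_side {c c' p q : E3} {r r' φ : ℝ} (h : IsLens c c' p q r r' φ)
    (hr : r ∈ Set.Ioc 0 (Real.pi / 2)) (hr' : r' ∈ Set.Ioc 0 (Real.pi / 2))
    (hφ : φ ∈ Set.Ioo 0 (Real.pi / 2)) :
    MeasureTheory.Measure.hausdorffMeasure (1 : ℝ) (sphCircle c r ∩ sphDisk c' r') =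
      ENNReal.ofReal (2 * lensAngle r r' φ * Real.sin r) := by
  obtain ⟨b, hc, hc', -, -⟩ := h.exists_frame hr hr' hφ
  have hθ0 := lensAngle_pos r r' φ
  have hθ1 := lensAngle_lt_pi r r' φ
  have hs := sin_pos_of_mem_Ioc hr
  have hcurve : ∀ t, circleCurve (Real.cos r • b 0) (b 1) (b 2) (Real.sin r) t =
      frameVec b (Real.cos r) (Real.sin r * Real.cos t) (Real.sin r * Real.sin t) := fun t => rfl
  have hdisk : ∀ t, ‖frameVec b (Real.cos r) (Real.sin r * Real.cos t)
      (Real.sin r * Real.sin t)‖ = 1 := fun t => by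
    rw [norm_frameVec_eq_one_iff]
    linear_combination Real.sin_sq_add_cos_sq r + Real.sin r ^ 2 * Real.sin_sq_add_cos_sq t
  have hcos : ∀ t, InnerProductGeometry.angle c' (frameVec b (Real.cos r) (Real.sin r * Real.cos t)
      (Real.sin r * Real.sin t)) < r' ↔ Real.cos (lensAngle r r' φ) < Real.cos t := fun t => by
    rw [angle_lt_iff h.norm_right (hdisk t) hr'.1.le (by linarith [hr'.2, Real.pi_pos]), hc',
      lensCenter, inner_frameVec, ← lensCos_mul_add (r := r) hr' hφ, zero_mul, add_zero,
      add_lt_add_iff_left, mul_lt_mul_iff_right₀ (lensSin_pos hr' hφ), mul_lt_mul_iff_right₀ hs]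
  have hset : sphCircle c r ∩ sphDisk c' r' =
      circleCurve (Real.cos r • b 0) (b 1) (b 2) (Real.sin r) ''
        Set.Ioo (-lensAngle r r' φ) (lensAngle r r' φ) := by
    ext v
    constructor
    · rintro ⟨h1, h2⟩
      obtain ⟨x, y, z, rfl⟩ : ∃ x y z, v = frameVec b x y z := ⟨_, _, _, eq_frameVec b v⟩
      have hx := inner_eq_of_mem_sphCircle h.norm_left hr h1
      rw [hc, inner_frameVec, one_mul, zero_mul, zero_mul, add_zero, add_zero] at hx
      have hn := (norm_frameVec_eq_one_iff b x y z).1 h1.1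
      obtain ⟨t, ht, hy, hz⟩ := exists_cos_sin_eq (x := y / Real.sin r) (y := z / Real.sin r) (by
        rw [div_pow, div_pow, ← add_div, div_eq_one_iff_eq (pow_pos hs 2).ne', Real.sin_sq, ← hx]
        linarith)
      rw [div_eq_iff hs.ne', mul_comm] at hy hz
      subst hx hy hz
      refine ⟨t, ?_, rfl⟩
      have h3 := (hcos t).1 h2.2
      rw [← Real.cos_abs t, Real.strictAntiOn_cos.lt_iff_gt ⟨hθ0.le, hθ1.le⟩
        ⟨abs_nonneg t, abs_le.2 ⟨ht.1.le, ht.2⟩⟩] at h3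
      exact abs_lt.1 h3
    · rintro ⟨t, ht, rfl⟩
      rw [hcurve]
      refine ⟨(mem_sphCircle_iff h.norm_left hr).2 ⟨hdisk t, ?_⟩, hdisk t, (hcos t).2 ?_⟩
      · rw [hc, inner_frameVec]; ring
      · rw [← Real.cos_abs t]
        exact Real.strictAntiOn_cos ⟨abs_nonneg t, (abs_lt.2 ht).le.trans hθ1.le⟩
          ⟨hθ0.le, hθ1.le⟩ (abs_lt.2 ht)
  rw [hset, hausdorffMeasure_circleCurve (b.norm_eq_one 1) (b.norm_eq_one 2)
    (b.orthonormal.2 (by decide)) hs hθ0.le hθ1.le]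

theorem sqrt_one_add_cot_sq {r : ℝ} (hr : r ∈ Set.Ioc 0 (Real.pi / 2)) :
    √(1 + Real.cot r ^ 2) = (Real.sin r)⁻¹ := by
  have hs := sin_pos_of_mem_Ioc hr
  rw [Real.sqrt_eq_iff_mul_self_eq (by positivity) (by positivity), Real.cot_eq_cos_div_sin]
  field_simp
  linarith [Real.sin_sq_add_cos_sq r]

theorem cot_mul_lensAngle {r : ℝ} (hr : r ∈ Set.Ioc 0 (Real.pi / 2)) (r' φ : ℝ) :
    Real.cot r * (2 * lensAngle r r' φ * Real.sin r) =
      sideCurvature φ (Real.cot r) (Real.cot r') := by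
  have hs := sin_pos_of_mem_Ioc hr
  have h1 : halfAngle φ (Real.cot r) (Real.cot r') = lensAngle r r' φ := by
    rw [halfAngle, lensAngle, sqrt_one_add_cot_sq hr, ← div_eq_mul_inv, div_div_eq_mul_div]
    congr 3
    rw [add_mul, mul_comm (Real.cot r'), Real.cot_eq_cos_div_sin r]
    field_simp
  rw [sideCurvature, h1, cosRadius, sqrt_one_add_cot_sq hr, div_inv_eq_mul]
  ring

theorem cot_nonneg {r : ℝ} (hr : r ∈ Set.Ioc 0 (Real.pi / 2)) : 0 ≤ Real.cot r := by
  rw [Real.cot_eq_cos_div_sin]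
  exact div_nonneg (Real.cos_nonneg_of_mem_Icc ⟨by linarith [hr.1, Real.pi_pos], hr.2⟩)
    (sin_pos_of_mem_Ioc hr).le

theorem pi_div_two_sub_arctan_mem {x : ℝ} (hx : 0 ≤ x) :
    Real.pi / 2 - Real.arctan x ∈ Set.Ioc 0 (Real.pi / 2) :=
  ⟨by linarith [Real.arctan_lt_pi_div_two x], by linarith [Real.arctan_nonneg.2 hx]⟩

theorem cot_pi_div_two_sub_arctan (x : ℝ) : Real.cot (Real.pi / 2 - Real.arctan x) = x := by
  rw [Real.cot_eq_cos_div_sin, Real.cos_pi_div_two_sub, Real.sin_pi_div_two_sub,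
    ← Real.tan_eq_sin_div_cos, Real.tan_arctan]

theorem cot_injOn : Set.InjOn Real.cot (Set.Ioc 0 (Real.pi / 2)) := by
  intro r hr r' hr' h
  rw [Real.cot_eq_cos_div_sin, Real.cot_eq_cos_div_sin] at h
  have h1 := arctan_cot hr.1 (by linarith [hr.2, Real.pi_pos])
  have h2 := arctan_cot hr'.1 (by linarith [hr'.2, Real.pi_pos])
  rw [h, h2] at h1
  linarith

variable {S E F : Type*} [TopologicalSpace S] {D : CellularDecomposition S E F} {Φ : E → ℝ}

namespace SphericalConicalMetric

theorem isLens (μ : SphericalConicalMetric D Φ) (e : E) (b : Bool) :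
    IsLens (μ.center e b) (μ.center e (!b)) (μ.corner e false) (μ.corner e true)
      (μ.sideRadius e b) (μ.sideRadius e (!b)) (Φ e) := by
  have h : IsLens (μ.center e false) (μ.center e true) (μ.corner e false) (μ.corner e true)
      (μ.sideRadius e false) (μ.sideRadius e true) (Φ e) :=
    ⟨μ.norm_center e _, μ.norm_center e _, μ.corner_mem e _ _, μ.corner_mem e _ _,
      μ.corner_mem e _ _, μ.corner_mem e _ _, μ.corner_ne e, μ.angle_corner e _⟩
  cases b
  · exact h
  · exact h.symm

theorem sideRadius_mem (μ : SphericalConicalMetric D Φ) (e : E) (b : Bool) :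
    μ.sideRadius e b ∈ Set.Ioc 0 (Real.pi / 2) := μ.radius_mem _

theorem geodesicCurvature_nonneg (μ : SphericalConicalMetric D Φ) (f : F) :
    0 ≤ μ.geodesicCurvature f := cot_nonneg (μ.radius_mem f)

theorem totalGeodesicCurvature_eq [Fintype E] (hΦ : ∀ e, Φ e ∈ Set.Ioo 0 (Real.pi / 2))
    (μ : SphericalConicalMetric D Φ) :
    μ.totalGeodesicCurvature = curvatureMap D.toFlagGluing Φ μ.geodesicCurvature := by
  classical
  funext f
  unfold totalGeodesicCurvature curvatureMap
  refine Finset.sum_congr rfl fun s hs => ?_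
  obtain rfl := (Finset.mem_filter.1 hs).2
  have hr := μ.sideRadius_mem s.1 s.2
  have h := (μ.isLens s.1 s.2).hausdorffMeasure_side hr (μ.sideRadius_mem _ _) (hΦ _)
  have h0 := lensAngle_pos (μ.sideRadius s.1 s.2) (μ.sideRadius s.1 (!s.2)) (Φ s.1)
  have h1 := sin_pos_of_mem_Ioc hr
  rw [sideLength, bigonSide, h, ENNReal.toReal_ofReal (by positivity)]
  exact cot_mul_lensAngle hr _ _

theorem radius_eq {μ ν : SphericalConicalMetric D Φ}
    (h : μ.geodesicCurvature = ν.geodesicCurvature) : μ.radius = ν.radius :=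
  funext fun f => cot_injOn (μ.radius_mem f) (ν.radius_mem f) (congrFun h f)

/-- The quadrilaterals of a 1-cell are congruent if the radii agree. -/
theorem exists_congruence (hΦ : ∀ e, Φ e ∈ Set.Ioo 0 (Real.pi / 2))
    {μ ν : SphericalConicalMetric D Φ} (h : μ.radius = ν.radius) (e : E) :
    ∃ R : E3 ≃ₗᵢ[ℝ] E3, (∀ b, R (μ.center e b) = ν.center e b) ∧
      ∀ b, R (μ.corner e b) = ν.corner e b := by
  obtain ⟨b, h1, h2, h3, h4⟩ := (μ.isLens e false).exists_frame (μ.sideRadius_mem _ _)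
    (μ.sideRadius_mem _ _) (hΦ e)
  obtain ⟨b', h1', h2', h3', h4'⟩ := (ν.isLens e false).exists_frame (ν.sideRadius_mem _ _)
    (ν.sideRadius_mem _ _) (hΦ e)
  have hs : ∀ b, ν.sideRadius e b = μ.sideRadius e b := fun b => by
    rw [sideRadius, sideRadius, h]
  rw [hs, hs] at h2' h3' h4'
  -- Both lenses have the same coordinates in their frames, so the change of frame is the
  -- congruence.
  have hR : ∀ x y z, b.equiv b' (Equiv.refl _) (frameVec b x y z) = frameVec b' x y z := by
    intro x y z
    simp [frameVec, OrthonormalBasis.equiv_apply_basis]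
  refine ⟨b.equiv b' (Equiv.refl _), ?_, ?_⟩
  · rintro (_ | _)
    · rw [h1, hR, h1']
    · exact (congrArg _ h2).trans ((hR _ _ _).trans h2'.symm)
  · rintro (_ | _)
    · rw [h3, lensCorner, hR, h3', lensCorner]
    · rw [h4, lensCorner, hR, h4', lensCorner]

/-- Metrics with the same radii are isometric by the identity. -/
theorem isometric_of_radius_eq (hΦ : ∀ e, Φ e ∈ Set.Ioo 0 (Real.pi / 2))
    {μ ν : SphericalConicalMetric D Φ} (h : μ.radius = ν.radius) : μ.Isometric ν := by
  choose R hcen hcor using exists_congruence hΦ h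
  have hs : ∀ e b, ν.sideRadius e b = μ.sideRadius e b := fun e b => by
    rw [sideRadius, sideRadius, h]
  have hangle : ∀ e v w, InnerProductGeometry.angle (R e v) (R e w) =
      InnerProductGeometry.angle v w := fun e => (R e).toLinearIsometry.angle_map
  have hedge : ∀ e, ν.edgePoint e = R e (μ.edgePoint e) := fun e => by
    simp only [edgePoint, ← hcen, hs, map_smul, map_add, hangle]
  have hchart : ∀ x p, ν.chart x p = R x.1 (μ.chart x p) := fun x p => by
    simp only [chart, ← hcen, ← hcor, hedge, ← map_smul, ← map_add, LinearIsometryEquiv.norm_map]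
  have hstep : ν.stepDist = μ.stepDist := by
    funext x y
    simp only [stepDist, hchart, hangle]
  -- Distances and disks are read off from angles between vectors belonging to a single 1-cell,
  -- which its congruence preserves, so the two metrics and patterns on `S` coincide.
  refine ⟨Homeomorph.refl S, fun x y => ?_, fun f => ?_, ?_⟩
  · simp only [gluedDist, hstep, Homeomorph.refl_apply]
    rfl
  · refine (Set.image_id _).trans ?_
    simp only [disk, sphDisk, hchart, ← hcen, Set.mem_ofPred_eq, LinearIsometryEquiv.norm_map,
      hangle, h]
  · exact ⟨⟨Prod.snd, continuous_snd⟩, fun _ => rfl, fun _ => rfl, fun _ => IsHomeomorph.id⟩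

/-- The quadrilaterals are linked only through the common radii, so each lens can be placed
independently in the standard frame. -/
theorem exists_geodesicCurvature_eq (D : CellularDecomposition S E F)
    (hΦ : ∀ e, Φ e ∈ Set.Ioo 0 (Real.pi / 2)) {k : F → ℝ} (hk : ∀ f, 0 ≤ k f) :
    ∃ μ : SphericalConicalMetric D Φ, μ.geodesicCurvature = k := by
  let r : F → ℝ := fun f => Real.pi / 2 - Real.arctan (k f)
  have hr : ∀ f, r f ∈ Set.Ioc 0 (Real.pi / 2) := fun f => pi_div_two_sub_arctan_mem (hk f)
  let B : OrthonormalBasis (Fin 3) ℝ E3 := EuclideanSpace.basisFun (Fin 3) ℝ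
  have hlens := fun e (σ : ℝ) (hσ : σ ^ 2 = 1) => isLens_frame B (hr (D.sideFace e false))
    (hr (D.sideFace e true)) (hΦ e) hσ
  have h1 := fun e => hlens e 1 (by norm_num)
  -- The lens with its corners exchanged supplies the angle condition at the second corner.
  have h2 := fun e => hlens e (-1) (by norm_num)
  simp only [neg_neg] at h2
  refine ⟨{
    radius := r
    radius_mem := hr
    center := fun e b =>
      if b then lensCenter B (r (D.sideFace e false)) (r (D.sideFace e true)) (Φ e)
      else frameVec B 1 0 0
    corner := fun e h => lensCorner B (r (D.sideFace e false)) (r (D.sideFace e true)) (Φ e)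
      (if h then -1 else 1)
    norm_center := ?_
    corner_mem := ?_
    corner_ne := fun e => (h1 e).ne
    angle_corner := ?_ }, funext fun f => cot_pi_div_two_sub_arctan (k f)⟩
  · rintro e (_ | _)
    · exact (h1 e).norm_left
    · exact (h1 e).norm_right
  · rintro e (_ | _) (_ | _)
    · exact (h1 e).left_mem
    · exact (h1 e).left_mem'
    · exact (h1 e).right_mem
    · exact (h1 e).right_mem'
  · rintro e (_ | _)
    · exact (h1 e).angle_eq
    · exact (h2 e).angle_eq

end SphericalConicalMetric

end

end CirclePattern

end

open CirclePattern
theorem theorem1p6 {S E F : Type*} [TopologicalSpace S] [T2Space S] [CompactSpace S]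
    [ChartedSpace (EuclideanSpace ℝ (Fin 2)) S] [Fintype E] [Fintype F]
    (D : CellularDecomposition S E F) (Φ : E → ℝ) (hΦ : ∀ e, Φ e ∈ Set.Ioo 0 (Real.pi / 2)) :
    -- existence
    (∀ L : F → ℝ, (∃ μ : SphericalConicalMetric D Φ, μ.totalGeodesicCurvature = L) ↔
      L ∈ LSet D.toFlagGluing Φ) ∧
    -- uniqueness
    (∀ μ ν : SphericalConicalMetric D Φ,
      μ.totalGeodesicCurvature = ν.totalGeodesicCurvature → μ.Isometric ν) ∧
    -- every `k ≥ 0` is the vector of geodesic curvatures of a metric, unique up to isometry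
    (∀ k : F → ℝ, (∀ f, 0 ≤ k f) →
      ∃ μ : SphericalConicalMetric D Φ, μ.geodesicCurvature = k) ∧
    (∀ μ ν : SphericalConicalMetric D Φ,
      μ.geodesicCurvature = ν.geodesicCurvature → μ.Isometric ν) ∧
    -- the curvature map is a homeomorphism that respects interior and boundary strata
    ∃ curv : {k : F → ℝ // ∀ f, 0 ≤ k f} ≃ₜ LSet D.toFlagGluing Φ,
      (∀ (μ : SphericalConicalMetric D Φ) (k : {k : F → ℝ // ∀ f, 0 ≤ k f}),
        μ.geodesicCurvature = k.1 → μ.totalGeodesicCurvature = (curv k).1) ∧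
      (∀ k, (∀ f, 0 < k.1 f) ↔ (curv k).1 ∈ L₁ D.toFlagGluing Φ) ∧
      (∀ k, k.1 ∈ orthantBoundary ↔ (curv k).1 ∈ LBoundary D.toFlagGluing Φ) ∧
      (∀ (I : Finset F) k, k.1 ∈ orthantStratum I ↔
        (curv k).1 ∈ LStratum D.toFlagGluing Φ I) := by
  have hiso : ∀ μ ν : SphericalConicalMetric D Φ,
      μ.geodesicCurvature = ν.geodesicCurvature → μ.Isometric ν := fun μ ν h =>
    SphericalConicalMetric.isometric_of_radius_eq hΦ (SphericalConicalMetric.radius_eq h)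
  have htot := fun μ : SphericalConicalMetric D Φ => μ.totalGeodesicCurvature_eq hΦ
  refine ⟨fun L => ⟨?_, fun hL => ?_⟩, fun μ ν h => hiso μ ν ?_,
    fun k hk => SphericalConicalMetric.exists_geodesicCurvature_eq D hΦ hk, hiso,
    curvatureHomeomorph D.toFlagGluing hΦ, fun μ k h => ?_,
    fun k => pos_iff_curvatureMap_mem_L₁ D.toFlagGluing hΦ k.2,
    fun k => mem_orthantBoundary_iff D.toFlagGluing hΦ k.2,
    fun I k => mem_orthantStratum_iff D.toFlagGluing hΦ k.2 I⟩
  · rintro ⟨μ, rfl⟩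
    rw [htot]
    exact curvatureMap_mem_LSet D.toFlagGluing hΦ μ.geodesicCurvature_nonneg
  · obtain ⟨h1, h2⟩ := (mem_LSet_iff D.toFlagGluing hΦ L).1 hL
    obtain ⟨k, hk, rfl⟩ := exists_curvatureMap_eq D.toFlagGluing hΦ h1 h2
    obtain ⟨μ, rfl⟩ := SphericalConicalMetric.exists_geodesicCurvature_eq D hΦ hk
    exact ⟨μ, htot μ⟩
  · rw [htot, htot] at h
    exact curvatureMap_injOn D.toFlagGluing hΦ μ.geodesicCurvature_nonneg
      ν.geodesicCurvature_nonneg h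
  · rw [htot, h, coe_curvatureHomeomorph]
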